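/- Let $\mathfrak g$ be a real Lie algebra with basis $e_1,e_2,e_3$, and write $e_{ij}=e_i\wedge e_j$, $e_{123}=e_1\wedge e_2\wedge e_3$, $r=x\,e_{12}+y\,e_{13}+z\,e_{23}\in\Lambda^2\mathfrak g$. Let $[\cdot,\cdot]_S$ be the algebraic Schouten bracket on $\Lambda\mathfrak g$, $$[X_1\wedge\dots\wedge X_s,Y_1\wedge\dots\wedge Y_l]_S=\sum_{i,j}(-1)^{i+j}[X_i,Y_j]\wedge X_1\wedge\dots\widehat{X_i}\dots\wedge X_s\wedge Y_1\wedge\dots\widehat{Y_j}\dots\wedge Y_l ,$$ and $(\Lambda^m\mathfrak g)^{\mathfrak g}=\{w\in\Lambda^m\mathfrak g: [v,w]_S=0\ \forall v\in\mathfrak g\}$. A cocommutator is a linear map $\delta:\mathfrak g\to\Lambda^2\mathfrak g$ whose transpose is a Lie bracket on $\mathfrak g^*$ and which satisfies $\delta([u,v])=[u,\delta(v)]_S+[\delta(u),v]_S$; it is coboundary if $\delta=\delta_r:=[\cdot,r]_S$ for some $r\in\Lambda^2\mathfrak g$, and $r$ is an $r$-matrix if $\delta_r$ is a cocommutator. The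 mCYBE is the condition $[r,r]_S\in(\Lambda^3\mathfrak g)^{\mathfrak g}$. Cocommutators $\delta,\delta'$ are equivalent if $(\Lambda^2T)\circ\delta=\delta'\circ T$ for some $T\in\mathrm{Aut}(\mathfrak g)$. Consider the following nine (families of) commutation relations, given by $([e_1,e_2],[e_1,e_3],[e_3,e_2])$: $\mathfrak{sl}_2:(e_2,-e_3,-e_1)$; $\mathfrak{su}_2:(e_3,-e_2,-e_1)$; $\mathfrak h:(e_3,0,0)$; $\mathfrak r'_{3,0}:(-e_3,e_2,0)$; $\mathfrak r_{3,-1}:(e_2,-e_3,0)$; $\mathfrak r_{3,1}:(e_2,e_3,0)$; $\mathfrak r_3:(0,-e_1,e_1+e_2)$; $\mathfrak r_{3,\lambda}$, $\lambda\in(-1,1)$: $(0,-e_1,\lambda e_2)$; $\mathfrak r'_{3,\lambda}$, $\lambda\neq0$: $(0,\,e_2-\lambda e_1,\,\lambda e_2+e_1)$. Each of them defines a Lie algebra, and every non-abelian real three-dimensional Lie algebra has a basis that satisfies one of them. For a Lie algebra with such a basis the following holds. 1. $(\Lambda^2\mathfrak g)^{\mathfrak g}$ is $\langle e_{13},e_{23}\rangle$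 for $\mathfrak h$, $\langle e_{23}\rangle$ for $\mathfrak r'_{3,0}$ and $\mathfrak r_{3,-1}$, and $0$ in all other cases. $(\Lambda^3\mathfrak g)^{\mathfrak g}$ is $\Lambda^3\mathfrak g$ for $\mathfrak{sl}_2,\mathfrak{su}_2,\mathfrak h,\mathfrak r'_{3,0},\mathfrak r_{3,-1}$ and $0$ for $\mathfrak r_{3,1},\mathfrak r_3,\mathfrak r_{3,\lambda},\mathfrak r'_{3,\lambda}$. 2. $[r,r]_S=c\,e_{123}$ with $c=2z^2-4xy$ for $\mathfrak{sl}_2$; $2(x^2+y^2+z^2)$ for $\mathfrak{su}_2$; $2x^2$ for $\mathfrak h$; $-2(x^2+y^2)$ for $\mathfrak r'_{3,0}$; $-4xy$ for $\mathfrak r_{3,-1}$; $0$ for $\mathfrak r_{3,1}$; $-2z^2$ for $\mathfrak r_3$; $2(\lambda-1)yz$ for $\mathfrak r_{3,\lambda}$; $-2(y^2+z^2)$ for $\mathfrak r'_{3,\lambda}$. 3. The solution set of the mCYBE, which is also the set of $r$-matrices, is $\{z=0\}$ for $\mathfrak r_3$, $\{y=0\}\cup\{z=0\}$ for $\mathfrak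 r_{3,\lambda}$, $\{y=z=0\}$ for $\mathfrak r'_{3,\lambda}$ and $\Lambda^2\mathfrak g$ in all other cases. 4. For $r$-matrices $r,r'$, the cocommutators $\delta_r,\delta_{r'}$ are equivalent if and only if the classes of $r$ and $r'$ in $\Lambda^2\mathfrak g/(\Lambda^2\mathfrak g)^{\mathfrak g}$ lie in the same orbit of $\mathrm{Aut}(\mathfrak g)$. The sets of $r$-matrices that induce equivalent nonzero cocommutators are exactly: - $\mathfrak{sl}_2$: $\{2xy-z^2=k\}$ for each $k\neq0$, and $\{2xy-z^2=0,\ x^2+y^2\ne0\}$; - $\mathfrak{su}_2$: $\{x^2+y^2+z^2=k\}$ for each $k>0$; - $\mathfrak h$: $\{x\ne0\}$; - $\mathfrak r'_{3,0}$: $\{x^2+y^2>0\}$; - $\mathfrak r_{3,-1}$: $\{xy=0,\ x^2+y^2\neq0\}$ and $\{xy\ne0\}$; - $\mathfrak r_{3,1}$: $\{x^2+y^2\ne0\}$ and $\{x=y=0,\ z\neq0\}$; - $\mathfrak r_3$: $\{x>0,y=z=0\}$, $\{x<0,y=z=0\}$ and $\{y\neq0,z=0\}$; - $\mathfrak r_{3,\lambda}$: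 $\{y=0,z\ne0\}$, $\{z=0,y\neq0\}$ and $\{y=z=0,x\ne0\}$; - $\mathfrak r'_{3,\lambda}$: $\{x>0,y=z=0\}$ and $\{x<0,y=z=0\}$. 5. Every nonzero coboundary cocommutator is equivalent to $\delta_r$ for exactly one $r$ in the following list, and every $r$ in the list is an $r$-matrix with $\delta_r\neq0$: - $\mathfrak{sl}_2$: $a\,e_{23}$ $(a>0)$, $a(e_{12}+e_{13})$ $(a>0)$, $e_{12}$; - $\mathfrak{su}_2$: $a\,e_{12}$ $(a>0)$; - $\mathfrak h$: $e_{12}$; $\ \mathfrak r'_{3,0}$: $e_{12}$; - $\mathfrak r_{3,-1}$: $e_{12}$, $e_{12}-e_{13}$; - $\mathfrak r_{3,1}$: $e_{13}$, $e_{23}$; - $\mathfrak r_3$: $e_{12}$, $-e_{12}$, $e_{13}$; - $\mathfrak r_{3,\lambda}$: $e_{12}$, $e_{23}$, $e_{13}$; - $\mathfrak r'_{3,\lambda}$: $e_{12}$, $-e_{12}$. -/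

import Mathlib

open Module

noncomputable section

namespace CoboundaryLie

section Schouten

variable {L : Type*} [LieRing L] [LieAlgebra ℝ L] {κ : Type*} [Fintype κ]

/-- Contraction of a multivector with a covector,
`ι_θ (X₁ ∧ ⋯ ∧ Xₙ) = ∑ᵢ (-1)^(i+1) θ(Xᵢ) X₁ ∧ ⋯ X̂ᵢ ⋯ ∧ Xₙ`. -/
def contract (θ : Dual ℝ L) : ExteriorAlgebra ℝ L →ₗ[ℝ] ExteriorAlgebra ℝ L :=
  CliffordAlgebra.contractLeft (Q := (0 : QuadraticForm ℝ L)) θ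

theorem contract_ι_mul (θ : Dual ℝ L) (v : L) (w : ExteriorAlgebra ℝ L) :
    contract θ (ExteriorAlgebra.ι ℝ v * w) =
      θ v • w - ExteriorAlgebra.ι ℝ v * contract θ w :=
  CliffordAlgebra.contractLeft_ι_mul (Q := (0 : QuadraticForm ℝ L)) θ v w

theorem contract_ιMulti (θ : Dual ℝ L) : ∀ (n : ℕ) (X : Fin (n + 1) → L),
    contract θ (ExteriorAlgebra.ιMulti ℝ (n + 1) X) =
      ∑ i : Fin (n + 1), ((-1 : ℝ) ^ (i : ℕ) * θ (X i)) •
        ExteriorAlgebra.ιMulti ℝ n (fun k => X (i.succAbove k))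
  | 0, X => by
      have h1 : contract θ (1 : ExteriorAlgebra ℝ L) = 0 :=
        CliffordAlgebra.contractLeft_one (Q := (0 : QuadraticForm ℝ L)) θ
      have h2 := contract_ι_mul θ (X 0) 1
      rw [mul_one, h1, mul_zero, sub_zero] at h2
      simp [ExteriorAlgebra.ιMulti_succ_apply, h2]
  | n + 1, X => by
      rw [ExteriorAlgebra.ιMulti_succ_apply, contract_ι_mul, contract_ιMulti θ n,
        Fin.sum_univ_succ (n := n + 1), Finset.mul_sum, sub_eq_add_neg, ← Finset.sum_neg_distrib]
      congr 1
      · simp [Matrix.vecTail, Function.comp_def]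
      · refine Finset.sum_congr rfl fun i _ => ?_
        rw [ExteriorAlgebra.ιMulti_succ_apply, mul_smul_comm, ← neg_smul]
        simp [Matrix.vecTail, Function.comp_def, pow_succ]

theorem contract_mem (θ : Dual ℝ L) (n : ℕ) {w : ExteriorAlgebra ℝ L}
    (hw : w ∈ ⋀[ℝ]^(n + 1) L) : contract θ w ∈ ⋀[ℝ]^n L := by
  rw [← ExteriorAlgebra.ιMulti_span_fixedDegree] at hw
  induction hw using Submodule.span_induction with
  | mem x hx =>
      obtain ⟨X, rfl⟩ := hx
      rw [contract_ιMulti]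
      exact Submodule.sum_mem _ fun i _ => Submodule.smul_mem _ _
        (ExteriorAlgebra.ιMulti_range ℝ n ⟨_, rfl⟩)
  | zero => simp
  | add x y _ _ hx hy => rw [map_add]; exact Submodule.add_mem _ hx hy
  | smul c x _ hx => rw [map_smul]; exact Submodule.smul_mem _ _ hx

/-- The value of the algebraic Schouten bracket, written with a basis `e` of the Lie algebra and
the dual basis `e*`: `[X, Y] = ∑ᵢⱼ [eᵢ, eⱼ] ∧ ι_{e*ᵢ} X ∧ ι_{e*ⱼ} Y`. By `schouten_ιMulti` it is
the usual bracket, so it does not depend on the basis. -/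
def schoutenVal (e : Basis κ ℝ L) (X Y : ExteriorAlgebra ℝ L) : ExteriorAlgebra ℝ L :=
  ∑ i, ∑ j, ExteriorAlgebra.ι ℝ ⁅e i, e j⁆ * contract (e.coord i) X * contract (e.coord j) Y

theorem schoutenVal_mem (e : Basis κ ℝ L) (p q : ℕ) {X Y : ExteriorAlgebra ℝ L}
    (hX : X ∈ ⋀[ℝ]^(p + 1) L) (hY : Y ∈ ⋀[ℝ]^(q + 1) L) :
    schoutenVal e X Y ∈ ⋀[ℝ]^(p + q + 1) L := by
  refine Submodule.sum_mem _ fun i _ => Submodule.sum_mem _ fun j _ => ?_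
  have h1 : ExteriorAlgebra.ι ℝ ⁅e i, e j⁆ ∈ ⋀[ℝ]^1 L := by
    simp [ExteriorAlgebra.exteriorPower]
  have h := SetLike.mul_mem_graded (SetLike.mul_mem_graded h1 (contract_mem (e.coord i) p hX))
    (contract_mem (e.coord j) q hY)
  have hd : 1 + p + q = p + q + 1 := by omega
  rwa [hd] at h

/-- The algebraic Schouten bracket `Λ^(p+1) g × Λ^(q+1) g → Λ^(p+q+1) g`. -/
def schouten (e : Basis κ ℝ L) (p q : ℕ) :
    ⋀[ℝ]^(p + 1) L →ₗ[ℝ] ⋀[ℝ]^(q + 1) L →ₗ[ℝ] ⋀[ℝ]^(p + q + 1) L :=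
  LinearMap.mk₂ ℝ (fun X Y => ⟨schoutenVal e X Y, schoutenVal_mem e p q X.2 Y.2⟩)
    (fun X X' Y => Subtype.ext <| by
      simp [schoutenVal, mul_add, add_mul, Finset.sum_add_distrib])
    (fun c X Y => Subtype.ext <| by simp [schoutenVal, Finset.smul_sum])
    (fun X Y Y' => Subtype.ext <| by
      simp [schoutenVal, mul_add, Finset.sum_add_distrib])
    (fun c X Y => Subtype.ext <| by simp [schoutenVal, Finset.smul_sum])

/-- On decomposable multivectors,
`[X₁∧⋯∧Xₛ, Y₁∧⋯∧Yₗ] = ∑ᵢⱼ (-1)^(i+j) [Xᵢ,Yⱼ] ∧ X₁∧⋯X̂ᵢ⋯∧Xₛ ∧ Y₁∧⋯Ŷⱼ⋯∧Yₗ`. -/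
theorem schouten_ιMulti (e : Basis κ ℝ L) (p q : ℕ) (X : Fin (p + 1) → L) (Y : Fin (q + 1) → L) :
    (schouten e p q (exteriorPower.ιMulti ℝ (p + 1) X) (exteriorPower.ιMulti ℝ (q + 1) Y) :
        ExteriorAlgebra ℝ L) =
      ∑ i : Fin (p + 1), ∑ j : Fin (q + 1), (-1 : ℝ) ^ ((i : ℕ) + (j : ℕ)) •
        (ExteriorAlgebra.ι ℝ ⁅X i, Y j⁆ *
          ExteriorAlgebra.ιMulti ℝ p (fun k => X (i.succAbove k)) *
          ExteriorAlgebra.ιMulti ℝ q (fun k => Y (j.succAbove k))) := by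
  have key : ∀ u v : L, ExteriorAlgebra.ι ℝ ⁅u, v⁆ =
      ∑ a, ∑ b, (e.coord a u * e.coord b v) • ExteriorAlgebra.ι ℝ ⁅e a, e b⁆ := by
    intro u v
    conv_lhs => rw [← e.sum_repr u, ← e.sum_repr v]
    simp only [sum_lie, lie_sum, smul_lie, lie_smul, map_sum, map_smul, Finset.smul_sum, smul_smul,
      Basis.coord_apply]
    rw [Finset.sum_comm]
    simp only [mul_comm]
  change schoutenVal e (ExteriorAlgebra.ιMulti ℝ (p + 1) X) (ExteriorAlgebra.ιMulti ℝ (q + 1) Y) = _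
  set A := fun i : Fin (p + 1) => ExteriorAlgebra.ιMulti ℝ p (fun k => X (i.succAbove k)) with hA
  set B := fun j : Fin (q + 1) => ExteriorAlgebra.ιMulti ℝ q (fun k => Y (j.succAbove k)) with hB
  have hl : ∀ a b, ExteriorAlgebra.ι ℝ ⁅e a, e b⁆ *
      contract (e.coord a) (ExteriorAlgebra.ιMulti ℝ (p + 1) X) *
      contract (e.coord b) (ExteriorAlgebra.ιMulti ℝ (q + 1) Y) =
      ∑ i : Fin (p + 1), ∑ j : Fin (q + 1), (-1 : ℝ) ^ ((i : ℕ) + (j : ℕ)) •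
        (((e.coord a (X i) * e.coord b (Y j)) • ExteriorAlgebra.ι ℝ ⁅e a, e b⁆) * A i * B j) := by
    intro a b
    rw [contract_ιMulti, contract_ιMulti, Finset.mul_sum (a := ExteriorAlgebra.ι ℝ ⁅e a, e b⁆), Finset.sum_mul]
    refine Finset.sum_congr rfl fun i _ => ?_
    rw [Finset.mul_sum]
    refine Finset.sum_congr rfl fun j _ => ?_
    simp only [smul_mul_assoc, mul_smul_comm, smul_smul, hA, hB]
    congr 1
    ring
  simp only [schoutenVal, hl]
  simp only [Finset.sum_comm (s := (Finset.univ : Finset κ)) (t := (Finset.univ : Finset (Fin _)))]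
  refine Finset.sum_congr rfl fun i _ => Finset.sum_congr rfl fun j _ => ?_
  rw [key]
  simp only [Finset.sum_mul, Finset.smul_sum, hA, hB]

end Schouten

section Bialgebra

variable {L : Type*} [LieRing L] [LieAlgebra ℝ L] {κ : Type*} [Fintype κ]

/-- A vector of the Lie algebra, seen as a multivector of degree one. -/
def vec : L →ₗ[ℝ] ⋀[ℝ]^1 L := (exteriorPower.oneEquiv ℝ L).symm.toLinearMap

/-- The space `(Λ^(m+1) g)^g` of invariant multivectors of degree `m + 1`. -/
def invariants (e : Basis κ ℝ L) (m : ℕ) : Submodule ℝ (⋀[ℝ]^(m + 1) L) where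
  carrier := {w | ∀ v : L, schouten e 0 m (vec v) w = 0}
  add_mem' := fun {a b} ha hb v => by rw [map_add, ha v, hb v, add_zero]
  zero_mem' := fun v => map_zero _
  smul_mem' := fun c a ha v => by rw [map_smul, ha v, smul_zero]

/-- `(Λ² g)^g`. -/
def inv2 (e : Basis κ ℝ L) : Submodule ℝ (⋀[ℝ]^2 L) := invariants e 1

/-- `(Λ³ g)^g`. -/
def inv3 (e : Basis κ ℝ L) : Submodule ℝ (⋀[ℝ]^3 L) := invariants e 2

/-- `[r, r]_S` for a bivector `r`. -/
def schoutenSq (e : Basis κ ℝ L) (r : ⋀[ℝ]^2 L) : ⋀[ℝ]^3 L := schouten e 1 1 r r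

/-- The modified classical Yang-Baxter equation `[r, r]_S ∈ (Λ³ g)^g`. -/
def MCYBE (e : Basis κ ℝ L) (r : ⋀[ℝ]^2 L) : Prop := schoutenSq e r ∈ inv3 e

/-- The map `δ_r : v ↦ [v, r]_S`. -/
def cobracket (e : Basis κ ℝ L) (r : ⋀[ℝ]^2 L) : L →ₗ[ℝ] ⋀[ℝ]^2 L :=
  (schouten e 0 1).flip r ∘ₗ vec

/-- The transpose `δ* : Λ² g* → g*`. -/
def transpose (δ : L →ₗ[ℝ] ⋀[ℝ]^2 L) : ⋀[ℝ]^2 (Dual ℝ L) →ₗ[ℝ] Dual ℝ L :=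
  δ.dualMap ∘ₗ exteriorPower.pairingDual ℝ L 2

/-- The bracket `[θ, η] = δ*(θ ∧ η)` on `g*`, bilinear and alternating by construction. -/
def dualBracket (δ : L →ₗ[ℝ] ⋀[ℝ]^2 L) (θ η : Dual ℝ L) : Dual ℝ L :=
  transpose δ (exteriorPower.ιMulti ℝ 2 ![θ, η])

/-- `(g, δ)` is a Lie bialgebra: `δ` is a cocycle, and `δ*` is a Lie bracket on `g*`. -/
structure IsCocommutator (e : Basis κ ℝ L) (δ : L →ₗ[ℝ] ⋀[ℝ]^2 L) : Prop where
  cocycle : ∀ u v : L, δ ⁅u, v⁆ = schouten e 0 1 (vec u) (δ v) + schouten e 1 0 (δ u) (vec v)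
  jacobi : ∀ θ η ζ : Dual ℝ L,
    dualBracket δ θ (dualBracket δ η ζ) + dualBracket δ η (dualBracket δ ζ θ) +
      dualBracket δ ζ (dualBracket δ θ η) = 0

/-- `r` is an r-matrix: `(g, δ_r)` is a Lie bialgebra. -/
def IsRMatrix (e : Basis κ ℝ L) (r : ⋀[ℝ]^2 L) : Prop := IsCocommutator e (cobracket e r)

/-- `(g, δ)` is a coboundary Lie bialgebra. -/
def IsCoboundary (e : Basis κ ℝ L) (δ : L →ₗ[ℝ] ⋀[ℝ]^2 L) : Prop :=
  IsCocommutator e δ ∧ ∃ r : ⋀[ℝ]^2 L, δ = cobracket e r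

/-- `Λ² T` for a Lie algebra automorphism `T`. -/
def mapTwo (T : L ≃ₗ⁅ℝ⁆ L) : ⋀[ℝ]^2 L →ₗ[ℝ] ⋀[ℝ]^2 L :=
  exteriorPower.map 2 T.toLinearEquiv.toLinearMap

/-- Equivalence of cocommutators under Lie algebra automorphisms: `(Λ² T) ∘ δ = δ' ∘ T`. -/
def CocommutatorEquiv (δ δ' : L →ₗ[ℝ] ⋀[ℝ]^2 L) : Prop :=
  ∃ T : L ≃ₗ⁅ℝ⁆ L, ∀ v : L, mapTwo T (δ v) = δ' (T v)

/-- The classes of `r` and `r'` in `Λ²_R g = Λ² g / (Λ² g)^g` lie in one orbit of the action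
`T · [r] = [Λ² T r]` of the automorphism group. -/
def ReducedEquiv (e : Basis κ ℝ L) (r r' : ⋀[ℝ]^2 L) : Prop :=
  ∃ T : L ≃ₗ⁅ℝ⁆ L, (inv2 e).mkQ (mapTwo T r) = (inv2 e).mkQ r'

/-- All r-matrices whose cocommutator is equivalent to that of `r`. -/
def rClass (e : Basis κ ℝ L) (r : ⋀[ℝ]^2 L) : Set (⋀[ℝ]^2 L) :=
  {r' | IsRMatrix e r' ∧ CocommutatorEquiv (cobracket e r) (cobracket e r')}

/-- The classes of r-matrices, up to equivalence of their cocommutators, that belong to nonzero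
cocommutators. -/
def nonzeroClasses (e : Basis κ ℝ L) : Set (Set (⋀[ℝ]^2 L)) :=
  {C | ∃ r, IsRMatrix e r ∧ cobracket e r ≠ 0 ∧ C = rClass e r}

end Bialgebra

section Table

variable {L : Type*} [LieRing L] [LieAlgebra ℝ L]

/-- `e₁ ∧ e₂`. The basis vectors `e₁, e₂, e₃` are `e 0, e 1, e 2`. -/
def e12 (e : Basis (Fin 3) ℝ L) : ⋀[ℝ]^2 L := exteriorPower.ιMulti ℝ 2 ![e 0, e 1]

/-- `e₁ ∧ e₃`. -/
def e13 (e : Basis (Fin 3) ℝ L) : ⋀[ℝ]^2 L := exteriorPower.ιMulti ℝ 2 ![e 0, e 2]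

/-- `e₂ ∧ e₃`. -/
def e23 (e : Basis (Fin 3) ℝ L) : ⋀[ℝ]^2 L := exteriorPower.ιMulti ℝ 2 ![e 1, e 2]

/-- `e₁ ∧ e₂ ∧ e₃`. -/
def e123 (e : Basis (Fin 3) ℝ L) : ⋀[ℝ]^3 L := exteriorPower.ιMulti ℝ 3 ![e 0, e 1, e 2]

/-- `x e₁₂ + y e₁₃ + z e₂₃`. -/
def bivec (e : Basis (Fin 3) ℝ L) (x y z : ℝ) : ⋀[ℝ]^2 L := x • e12 e + y • e13 e + z • e23 e

/-- The bivectors whose coordinates `x, y, z` with respect to `e₁₂, e₁₃, e₂₃` satisfy `P`. -/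
def locus (e : Basis (Fin 3) ℝ L) (P : ℝ → ℝ → ℝ → Prop) : Set (⋀[ℝ]^2 L) :=
  {r | ∃ x y z : ℝ, P x y z ∧ r = bivec e x y z}

/-- The rows of the table: `sl₂`, `su₂`, the Heisenberg algebra, `r'_{3,0}`, `r_{3,-1}`, `r_{3,1}`,
`r₃`, `r_{3,l}` with `-1 < l < 1`, and `r'_{3,l}` with `l ≠ 0`. -/
inductive Row : Type
  | sl2
  | su2
  | heis
  | r30'
  | r3m1
  | r31
  | r3
  | r3l (l : ℝ) (hl : -1 < l ∧ l < 1)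
  | r3l' (l : ℝ) (hl : l ≠ 0)

/-- The commutation relations of a row: the values of `[e₁, e₂]`, `[e₁, e₃]` and `[e₃, e₂]`. -/
def Row.Relations (t : Row) (e : Basis (Fin 3) ℝ L) : Prop :=
  match t with
  | .sl2 => ⁅e 0, e 1⁆ = e 1 ∧ ⁅e 0, e 2⁆ = -e 2 ∧ ⁅e 2, e 1⁆ = -e 0
  | .su2 => ⁅e 0, e 1⁆ = e 2 ∧ ⁅e 0, e 2⁆ = -e 1 ∧ ⁅e 2, e 1⁆ = -e 0
  | .heis => ⁅e 0, e 1⁆ = e 2 ∧ ⁅e 0, e 2⁆ = 0 ∧ ⁅e 2, e 1⁆ = 0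
  | .r30' => ⁅e 0, e 1⁆ = -e 2 ∧ ⁅e 0, e 2⁆ = e 1 ∧ ⁅e 2, e 1⁆ = 0
  | .r3m1 => ⁅e 0, e 1⁆ = e 1 ∧ ⁅e 0, e 2⁆ = -e 2 ∧ ⁅e 2, e 1⁆ = 0
  | .r31 => ⁅e 0, e 1⁆ = e 1 ∧ ⁅e 0, e 2⁆ = e 2 ∧ ⁅e 2, e 1⁆ = 0
  | .r3 => ⁅e 0, e 1⁆ = 0 ∧ ⁅e 0, e 2⁆ = -e 0 ∧ ⁅e 2, e 1⁆ = e 0 + e 1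
  | .r3l l _ => ⁅e 0, e 1⁆ = 0 ∧ ⁅e 0, e 2⁆ = -e 0 ∧ ⁅e 2, e 1⁆ = l • e 1
  | .r3l' l _ => ⁅e 0, e 1⁆ = 0 ∧ ⁅e 0, e 2⁆ = e 1 - l • e 0 ∧ ⁅e 2, e 1⁆ = l • e 1 + e 0

/-- The space of invariant bivectors of a row. -/
def Row.inv2 (t : Row) (e : Basis (Fin 3) ℝ L) : Submodule ℝ (⋀[ℝ]^2 L) :=
  match t with
  | .heis => Submodule.span ℝ {e13 e, e23 e}
  | .r30' => Submodule.span ℝ {e23 e}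
  | .r3m1 => Submodule.span ℝ {e23 e}
  | _ => ⊥

/-- The space of invariant trivectors of a row. -/
def Row.inv3 (t : Row) (L : Type*) [LieRing L] [LieAlgebra ℝ L] : Submodule ℝ (⋀[ℝ]^3 L) :=
  match t with
  | .sl2 => ⊤
  | .su2 => ⊤
  | .heis => ⊤
  | .r30' => ⊤
  | .r3m1 => ⊤
  | _ => ⊥

/-- The coefficient of `e₁₂₃` in `[r, r]_S` for `r = x e₁₂ + y e₁₃ + z e₂₃`. -/
def Row.schoutenCoeff (t : Row) (x y z : ℝ) : ℝ :=
  match t with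
  | .sl2 => 2 * z ^ 2 - 4 * x * y
  | .su2 => 2 * (x ^ 2 + y ^ 2 + z ^ 2)
  | .heis => 2 * x ^ 2
  | .r30' => -2 * (x ^ 2 + y ^ 2)
  | .r3m1 => -4 * x * y
  | .r31 => 0
  | .r3 => -2 * z ^ 2
  | .r3l l _ => 2 * (l - 1) * y * z
  | .r3l' _ _ => -2 * (y ^ 2 + z ^ 2)

/-- The solution set of the modified classical Yang-Baxter equation of a row, in coordinates. -/
def Row.YB (t : Row) (_x y z : ℝ) : Prop :=
  match t with
  | .r3 => z = 0
  | .r3l _ _ => y = 0 ∨ z = 0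
  | .r3l' _ _ => y = 0 ∧ z = 0
  | _ => True

/-- The classes of r-matrices of a row that belong to nonzero cocommutators. -/
def Row.classes (t : Row) (e : Basis (Fin 3) ℝ L) : Set (Set (⋀[ℝ]^2 L)) :=
  match t with
  | .sl2 =>
      {C | ∃ k : ℝ, k ≠ 0 ∧ C = locus e fun x y z => 2 * x * y - z ^ 2 = k} ∪
        {locus e fun x y z => 2 * x * y - z ^ 2 = 0 ∧ x ^ 2 + y ^ 2 ≠ 0}
  | .su2 => {C | ∃ k : ℝ, 0 < k ∧ C = locus e fun x y z => x ^ 2 + y ^ 2 + z ^ 2 = k}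
  | .heis => {locus e fun x _ _ => x ≠ 0}
  | .r30' => {locus e fun x y _ => 0 < x ^ 2 + y ^ 2}
  | .r3m1 => {locus e fun x y _ => x * y = 0 ∧ x ^ 2 + y ^ 2 ≠ 0, locus e fun x y _ => x * y ≠ 0}
  | .r31 => {locus e fun x y _ => x ^ 2 + y ^ 2 ≠ 0, locus e fun x y z => x = 0 ∧ y = 0 ∧ z ≠ 0}
  | .r3 =>
      {locus e fun x y z => 0 < x ∧ y = 0 ∧ z = 0, locus e fun x y z => x < 0 ∧ y = 0 ∧ z = 0,
        locus e fun _ y z => y ≠ 0 ∧ z = 0}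
  | .r3l _ _ =>
      {locus e fun _ y z => y = 0 ∧ z ≠ 0, locus e fun _ y z => z = 0 ∧ y ≠ 0,
        locus e fun x y z => y = 0 ∧ z = 0 ∧ x ≠ 0}
  | .r3l' _ _ =>
      {locus e fun x y z => 0 < x ∧ y = 0 ∧ z = 0, locus e fun x y z => x < 0 ∧ y = 0 ∧ z = 0}

/-- Representatives of the classes of a row. -/
def Row.reps (t : Row) (e : Basis (Fin 3) ℝ L) : Set (⋀[ℝ]^2 L) :=
  match t with
  | .sl2 =>
      {r | ∃ a : ℝ, 0 < a ∧ r = a • e23 e} ∪ {r | ∃ a : ℝ, 0 < a ∧ r = a • (e12 e + e13 e)} ∪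
        {e12 e}
  | .su2 => {r | ∃ a : ℝ, 0 < a ∧ r = a • e12 e}
  | .heis => {e12 e}
  | .r30' => {e12 e}
  | .r3m1 => {e12 e, e12 e - e13 e}
  | .r31 => {e13 e, e23 e}
  | .r3 => {e12 e, -e12 e, e13 e}
  | .r3l _ _ => {e12 e, e23 e, e13 e}
  | .r3l' _ _ => {e12 e, -e12 e}

end Table

end CoboundaryLie

end

/-!
A bivector `r` of a three-dimensional Lie algebra is the Hodge dual of a vector `p`, and the bracket
is `[u, v] = M (u × v)` for the structure matrix `M`. In these terms `[r, r]_S = 2 (pᵀ M p) e₁₂₃`,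
the unimodular algebras are those with `M` symmetric, and the change of basis by `Q` replaces `M`
by a multiple of a matrix congruent to it. Invariants, the mCYBE and the orbits of the group
`{Q | Q M Qᵀ = det Q • M}` of automorphisms are therefore computations with the matrix `M`, and
every algebra occurs in the table because congruence up to a factor brings the symmetric part of
`M` to a diagonal matrix with entries `0`, `1`, `-1`. That `r` is an `r`-matrix exactly if it solves
the mCYBE holds because twice the Jacobi expression of `δ_r` on covectors `θ, η, ζ` and a vector `v`
is the pairing of `θ ∧ η ∧ ζ` with `[v, [r, r]_S]_S`.
-/

noncomputable section

namespace CoboundaryLie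

open Module
open scoped Matrix

universe u

section ExteriorSquare

variable {R M N : Type*} [CommRing R] [AddCommGroup M] [Module R M] [AddCommGroup N] [Module R N]

/-- The exterior product `u ∧ v` of two vectors as a bilinear map, so that it can be expanded with
`map_add` and `map_smul`. -/
def wedge : M →ₗ[R] M →ₗ[R] ⋀[R]^2 M :=
  LinearMap.mk₂ R (fun u v => exteriorPower.ιMulti R 2 ![u, v])
    (fun u u' v => Subtype.ext <| by simp [ExteriorAlgebra.ιMulti_succ_apply, add_mul])
    (fun c u v => Subtype.ext <| by simp [ExteriorAlgebra.ιMulti_succ_apply])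
    (fun u v v' => Subtype.ext <| by simp [ExteriorAlgebra.ιMulti_succ_apply, mul_add])
    (fun c u v => Subtype.ext <| by simp [ExteriorAlgebra.ιMulti_succ_apply])

theorem wedge_apply (u v : M) : wedge u v = exteriorPower.ιMulti R 2 ![u, v] := rfl

theorem coe_wedge (u v : M) :
    (wedge u v : ⋀[R]^2 M) = ExteriorAlgebra.ι R u * ExteriorAlgebra.ι R v := by
  simp [wedge_apply, ExteriorAlgebra.ιMulti_succ_apply]

theorem wedge_self (u : M) : wedge (R := R) u u = 0 :=
  Subtype.ext <| by simp [coe_wedge]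

theorem wedge_swap (u v : M) : wedge (R := R) v u = -wedge u v :=
  Subtype.ext <| by simp [coe_wedge, eq_neg_iff_add_eq_zero, ExteriorAlgebra.ι_add_mul_swap]

theorem span_wedge :
    Submodule.span R (Set.range fun p : M × M => wedge (R := R) p.1 p.2) = ⊤ := by
  rw [eq_top_iff, ← exteriorPower.ιMulti_span R 2 M, Submodule.span_le]
  rintro _ ⟨v, rfl⟩
  refine Submodule.subset_span ⟨(v 0, v 1), ?_⟩
  exact congrArg (exteriorPower.ιMulti R 2) (List.ofFn_injective rfl)

theorem linearMap_ext_wedge {f g : ⋀[R]^2 M →ₗ[R] N} (h : ∀ u v, f (wedge u v) = g (wedge u v)) :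
    f = g :=
  LinearMap.ext_on_range span_wedge fun p => h p.1 p.2

theorem map_wedge (f : M →ₗ[R] N) (u v : M) :
    exteriorPower.map 2 f (wedge u v) = wedge (f u) (f v) := by
  rw [wedge_apply, exteriorPower.map_apply_ιMulti, wedge_apply]
  exact congrArg (exteriorPower.ιMulti R 2) (List.ofFn_injective rfl)

theorem pairingDual_wedge_wedge (θ η : Dual R M) (u v : M) :
    exteriorPower.pairingDual R M 2 (wedge θ η) (wedge u v) = θ u * η v - η u * θ v := by
  simp [wedge_apply, Matrix.det_fin_two, mul_comm]

end ExteriorSquare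

section Pairing

variable {R M : Type*} [CommRing R] [AddCommGroup M] [Module R M] [Module.Free R M]

theorem eq_zero_of_pairingDual_ιMulti_eq_zero {n : ℕ} {w : ⋀[R]^n M}
    (h : ∀ θ : Fin n → Dual R M,
      exteriorPower.pairingDual R M n (exteriorPower.ιMulti R n θ) w = 0) : w = 0 := by
  classical
  let b := Module.Free.chooseBasis R M
  let : LinearOrder (Module.Free.ChooseBasisIndex R M) := linearOrderOfSTO WellOrderingRel
  refine (b.exteriorPower n).ext_elem fun s => ?_
  rw [exteriorPower.basis_repr_apply, map_zero, Finsupp.zero_apply]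
  exact h _

end Pairing

section Bialgebra

variable {L : Type*} [LieRing L] [LieAlgebra ℝ L] {κ : Type*} [Fintype κ] (e : Basis κ ℝ L)

theorem vec_eq_ιMulti (v : L) : vec v = exteriorPower.ιMulti ℝ 1 ![v] := by
  rw [vec, LinearEquiv.coe_coe, LinearEquiv.symm_apply_eq, exteriorPower.oneEquiv_ιMulti]
  rfl

theorem coe_schouten_vec_ιMulti (v : L) (m : ℕ) (X : Fin (m + 1) → L) :
    (schouten e 0 m (vec v) (exteriorPower.ιMulti ℝ (m + 1) X) : ExteriorAlgebra ℝ L) =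
      ∑ j, ExteriorAlgebra.ιMulti ℝ (m + 1) (Function.update X j ⁅v, X j⁆) := by
  rw [vec_eq_ιMulti, schouten_ιMulti, Fin.sum_univ_one]
  refine Finset.sum_congr rfl fun j _ => ?_
  have hupdate : Function.update X j ⁅v, X j⁆ = j.insertNth ⁅v, X j⁆ (j.removeNth X) := by
    rw [Fin.insertNth_removeNth]
  rw [hupdate, AlternatingMap.map_insertNth, ExteriorAlgebra.ιMulti_succ_apply]
  simp [Fin.removeNth, Matrix.vecTail, Function.comp_def, Algebra.smul_def]

theorem schouten_vec_wedge (v a b : L) :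
    schouten e 0 1 (vec v) (wedge a b) = wedge ⁅v, a⁆ b + wedge a ⁅v, b⁆ :=
  Subtype.ext <| by simp [wedge_apply, coe_schouten_vec_ιMulti, Fin.sum_univ_two, Matrix.vecTail]

theorem schouten_vec_ιMulti_three (v a b c : L) :
    schouten e 0 2 (vec v) (exteriorPower.ιMulti ℝ 3 ![a, b, c]) =
      exteriorPower.ιMulti ℝ 3 ![⁅v, a⁆, b, c] + exteriorPower.ιMulti ℝ 3 ![a, ⁅v, b⁆, c] +
        exteriorPower.ιMulti ℝ 3 ![a, b, ⁅v, c⁆] :=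
  Subtype.ext <| by simp [coe_schouten_vec_ιMulti, Fin.sum_univ_three, Matrix.vecTail]

theorem schouten_wedge_vec (a b v : L) :
    schouten e 1 0 (wedge a b) (vec v) = wedge ⁅a, v⁆ b - wedge ⁅b, v⁆ a :=
  Subtype.ext <| by
    rw [vec_eq_ιMulti, wedge_apply, schouten_ιMulti]
    simp [coe_wedge, Fin.sum_univ_two, ExteriorAlgebra.ιMulti_succ_apply, sub_eq_add_neg]

theorem schouten_wedge_wedge (a b c d : L) :
    schouten e 1 1 (wedge a b) (wedge c d) =
      exteriorPower.ιMulti ℝ 3 ![⁅a, c⁆, b, d] - exteriorPower.ιMulti ℝ 3 ![⁅a, d⁆, b, c] -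
        exteriorPower.ιMulti ℝ 3 ![⁅b, c⁆, a, d] + exteriorPower.ιMulti ℝ 3 ![⁅b, d⁆, a, c] :=
  Subtype.ext <| by
    rw [wedge_apply, wedge_apply, schouten_ιMulti]
    simp [Fin.sum_univ_two, ExteriorAlgebra.ιMulti_succ_apply, mul_assoc, sub_eq_add_neg, add_assoc]

theorem cobracket_wedge (a b v : L) :
    cobracket e (wedge a b) v = wedge ⁅v, a⁆ b + wedge a ⁅v, b⁆ :=
  schouten_vec_wedge e v a b

theorem cobracket_add (r s : ⋀[ℝ]^2 L) : cobracket e (r + s) = cobracket e r + cobracket e s :=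
  LinearMap.ext fun v => map_add (schouten e 0 1 (vec v)) r s

theorem cobracket_smul (c : ℝ) (r : ⋀[ℝ]^2 L) : cobracket e (c • r) = c • cobracket e r :=
  LinearMap.ext fun v => map_smul (schouten e 0 1 (vec v)) c r

theorem cobracket_sub (r s : ⋀[ℝ]^2 L) : cobracket e (r - s) = cobracket e r - cobracket e s :=
  LinearMap.ext fun v => map_sub (schouten e 0 1 (vec v)) r s

theorem mem_inv2_iff {r : ⋀[ℝ]^2 L} : r ∈ inv2 e ↔ cobracket e r = 0 :=
  ⟨fun h => LinearMap.ext h, fun h v => LinearMap.congr_fun h v⟩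

theorem cobracket_eq_cobracket_iff {r s : ⋀[ℝ]^2 L} :
    cobracket e r = cobracket e s ↔ r - s ∈ inv2 e := by
  rw [mem_inv2_iff, cobracket_sub]
  exact (sub_eq_zero (a := cobracket e r)).symm

theorem schouten_vec_right (v : L) :
    (schouten e 1 0).flip (vec v) = -schouten e 0 1 (vec v) :=
  linearMap_ext_wedge fun a b => by
    rw [LinearMap.flip_apply, schouten_wedge_vec, LinearMap.neg_apply, schouten_vec_wedge,
      ← lie_skew v a, ← lie_skew v b, map_neg, map_neg, LinearMap.neg_apply, wedge_swap a ⁅b, v⁆]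
    abel

theorem schouten_vec_lie (u v : L) :
    schouten e 0 1 (vec ⁅u, v⁆) =
      schouten e 0 1 (vec u) ∘ₗ schouten e 0 1 (vec v) -
        schouten e 0 1 (vec v) ∘ₗ schouten e 0 1 (vec u) :=
  linearMap_ext_wedge fun a b => by
    simp only [LinearMap.sub_apply, LinearMap.comp_apply, schouten_vec_wedge, map_add, lie_lie,
      map_sub]
    abel

theorem cobracket_cocycle (r : ⋀[ℝ]^2 L) (u v : L) :
    cobracket e r ⁅u, v⁆ =
      schouten e 0 1 (vec u) (cobracket e r v) + schouten e 1 0 (cobracket e r u) (vec v) := by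
  have hright : schouten e 1 0 (cobracket e r u) (vec v) =
      -schouten e 0 1 (vec v) (cobracket e r u) :=
    LinearMap.congr_fun (schouten_vec_right e v) _
  rw [hright, ← sub_eq_add_neg]
  exact LinearMap.congr_fun (schouten_vec_lie e u v) r

theorem mapTwo_wedge (T : L ≃ₗ⁅ℝ⁆ L) (a b : L) : mapTwo T (wedge a b) = wedge (T a) (T b) :=
  map_wedge _ a b

theorem mapTwo_comp_schouten_vec (T : L ≃ₗ⁅ℝ⁆ L) (v : L) :
    mapTwo T ∘ₗ schouten e 0 1 (vec v) = schouten e 0 1 (vec (T v)) ∘ₗ mapTwo T :=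
  linearMap_ext_wedge fun a b => by
    rw [LinearMap.comp_apply, LinearMap.comp_apply, schouten_vec_wedge, mapTwo_wedge,
      schouten_vec_wedge, map_add, mapTwo_wedge, mapTwo_wedge, LieEquiv.map_lie, LieEquiv.map_lie]

theorem mapTwo_cobracket (T : L ≃ₗ⁅ℝ⁆ L) (r : ⋀[ℝ]^2 L) (v : L) :
    mapTwo T (cobracket e r v) = cobracket e (mapTwo T r) (T v) :=
  LinearMap.congr_fun (mapTwo_comp_schouten_vec e T v) r

theorem mapTwo_refl : mapTwo (LieEquiv.refl : L ≃ₗ⁅ℝ⁆ L) = LinearMap.id :=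
  exteriorPower.map_id

theorem mapTwo_trans (T S : L ≃ₗ⁅ℝ⁆ L) : mapTwo (T.trans S) = mapTwo S ∘ₗ mapTwo T :=
  exteriorPower.map_comp _ _

end Bialgebra

section Equivalence

variable {L : Type*} [LieRing L] [LieAlgebra ℝ L]

theorem CocommutatorEquiv.symm {δ δ' : L →ₗ[ℝ] ⋀[ℝ]^2 L} (h : CocommutatorEquiv δ δ') :
    CocommutatorEquiv δ' δ := by
  obtain ⟨T, hT⟩ := h
  have hinv : mapTwo T.symm ∘ₗ mapTwo T = LinearMap.id := by
    rw [← mapTwo_trans, LieEquiv.self_trans_symm, mapTwo_refl]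
  refine ⟨T.symm, fun v => ?_⟩
  rw [← T.apply_symm_apply v, ← hT, T.symm_apply_apply]
  exact LinearMap.congr_fun hinv _

theorem CocommutatorEquiv.trans {δ δ' δ'' : L →ₗ[ℝ] ⋀[ℝ]^2 L} (h : CocommutatorEquiv δ δ')
    (h' : CocommutatorEquiv δ' δ'') : CocommutatorEquiv δ δ'' := by
  obtain ⟨T, hT⟩ := h
  obtain ⟨S, hS⟩ := h'
  exact ⟨T.trans S, fun v => by
    rw [mapTwo_trans, LinearMap.comp_apply, hT, hS, LieEquiv.trans_apply]⟩

theorem CocommutatorEquiv.ne_zero {δ δ' : L →ₗ[ℝ] ⋀[ℝ]^2 L} (h : CocommutatorEquiv δ δ')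
    (hδ : δ ≠ 0) : δ' ≠ 0 := by
  rintro rfl
  obtain ⟨T, hT⟩ := h.symm
  refine hδ (LinearMap.ext fun v => ?_)
  rw [← T.apply_symm_apply v, ← hT, LinearMap.zero_apply, map_zero, LinearMap.zero_apply]

variable {κ : Type*} [Fintype κ] {e : Basis κ ℝ L} {r r' r'' : ⋀[ℝ]^2 L}

theorem cocommutatorEquiv_iff_reducedEquiv :
    CocommutatorEquiv (cobracket e r) (cobracket e r') ↔ ReducedEquiv e r r' := by
  refine exists_congr fun T => ?_
  simp only [mapTwo_cobracket]
  rw [Submodule.mkQ_apply, Submodule.mkQ_apply, Submodule.Quotient.eq,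
    ← cobracket_eq_cobracket_iff, LinearMap.ext_iff]
  refine ⟨fun h v => ?_, fun h v => h _⟩
  simpa only [LieEquiv.apply_symm_apply] using h (T.symm v)

theorem ReducedEquiv.symm (h : ReducedEquiv e r r') : ReducedEquiv e r' r :=
  cocommutatorEquiv_iff_reducedEquiv.1 (cocommutatorEquiv_iff_reducedEquiv.2 h).symm

theorem ReducedEquiv.trans (h : ReducedEquiv e r r') (h' : ReducedEquiv e r' r'') :
    ReducedEquiv e r r'' :=
  cocommutatorEquiv_iff_reducedEquiv.1
    ((cocommutatorEquiv_iff_reducedEquiv.2 h).trans (cocommutatorEquiv_iff_reducedEquiv.2 h'))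

end Equivalence

section YangBaxter

variable {L : Type*} [LieRing L] [LieAlgebra ℝ L] {κ : Type*} [Fintype κ] (e : Basis κ ℝ L)

theorem dualBracket_apply (δ : L →ₗ[ℝ] ⋀[ℝ]^2 L) (θ η : Dual ℝ L) (v : L) :
    dualBracket δ θ η v = exteriorPower.pairingDual ℝ L 2 (wedge θ η) (δ v) := rfl

theorem dualBracket_cobracket_wedge (a b : L) (θ η : Dual ℝ L) (v : L) :
    dualBracket (cobracket e (wedge a b)) θ η v =
      θ ⁅v, a⁆ * η b - η ⁅v, a⁆ * θ b + (θ a * η ⁅v, b⁆ - η a * θ ⁅v, b⁆) := by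
  rw [dualBracket_apply, cobracket_wedge, map_add, pairingDual_wedge_wedge,
    pairingDual_wedge_wedge]

/-- The Jacobi sum of the brackets on the dual space defined by `δ_r` and `δ_s`, evaluated at a
vector. The inner bracket comes from `s` and the outer one from `r`, so that the sum is bilinear. -/
def jacobiForm (θ η ζ : Dual ℝ L) (v : L) : ⋀[ℝ]^2 L →ₗ[ℝ] ⋀[ℝ]^2 L →ₗ[ℝ] ℝ :=
  LinearMap.mk₂ ℝ (fun r s =>
    dualBracket (cobracket e r) θ (dualBracket (cobracket e s) η ζ) v +
      dualBracket (cobracket e r) η (dualBracket (cobracket e s) ζ θ) v +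
        dualBracket (cobracket e r) ζ (dualBracket (cobracket e s) θ η) v)
    (fun r r' s => by
      simp only [dualBracket_apply, cobracket_add, LinearMap.add_apply, map_add]; ring)
    (fun c r s => by
      simp only [dualBracket_apply, cobracket_smul, LinearMap.smul_apply, map_smul, smul_eq_mul]
      ring)
    (fun r s s' => by
      have hadd (θ η : Dual ℝ L) : dualBracket (cobracket e (s + s')) θ η =
          dualBracket (cobracket e s) θ η + dualBracket (cobracket e s') θ η :=
        LinearMap.ext fun w => by simp [dualBracket_apply, cobracket_add]
      simp only [hadd, dualBracket_apply _ _ (_ + _), map_add, LinearMap.add_apply]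
      simp only [dualBracket_apply]
      ring)
    (fun c r s => by
      have hsmul (θ η : Dual ℝ L) : dualBracket (cobracket e (c • s)) θ η =
          c • dualBracket (cobracket e s) θ η :=
        LinearMap.ext fun w => by simp [dualBracket_apply, cobracket_smul]
      simp only [hsmul, dualBracket_apply _ _ (_ • _), map_smul, LinearMap.smul_apply, smul_eq_mul]
      simp only [dualBracket_apply]
      ring)

theorem jacobiForm_add_flip (θ η ζ : Dual ℝ L) (v : L) :
    jacobiForm e θ η ζ v + (jacobiForm e θ η ζ v).flip =
      (schouten e 1 1).compr₂ (exteriorPower.pairingDual ℝ L 3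
        (exteriorPower.ιMulti ℝ 3 ![θ, η, ζ]) ∘ₗ schouten e 0 2 (vec v)) :=
  linearMap_ext_wedge fun a b => linearMap_ext_wedge fun c d => by
    simp only [LinearMap.add_apply, LinearMap.flip_apply, jacobiForm, LinearMap.mk₂_apply,
      dualBracket_cobracket_wedge, LinearMap.compr₂_apply, LinearMap.comp_apply,
      schouten_wedge_wedge, map_add, map_sub, schouten_vec_ιMulti_three,
      exteriorPower.pairingDual_ιMulti_ιMulti, Matrix.det_fin_three]
    simp only [Matrix.cons_val, Matrix.of_apply]
    have hskew (u w : L) : ⁅w, u⁆ = -⁅u, w⁆ := (lie_skew w u).symm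
    simp only [leibniz_lie v, hskew a, hskew b, neg_lie, map_neg, map_add]
    ring

theorem isRMatrix_iff_mcybe {r : ⋀[ℝ]^2 L} : IsRMatrix e r ↔ MCYBE e r := by
  have hjacobi (θ η ζ : Dual ℝ L) (v : L) :
      2 * jacobiForm e θ η ζ v r r = exteriorPower.pairingDual ℝ L 3
        (exteriorPower.ιMulti ℝ 3 ![θ, η, ζ]) (schouten e 0 2 (vec v) (schoutenSq e r)) := by
    rw [two_mul]
    exact LinearMap.congr_fun₂ (jacobiForm_add_flip e θ η ζ v) r r
  constructor
  · intro h v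
    refine eq_zero_of_pairingDual_ιMulti_eq_zero fun θ => ?_
    have hθ : θ = ![θ 0, θ 1, θ 2] := List.ofFn_injective rfl
    rw [hθ, ← hjacobi]
    exact mul_eq_zero_of_right _ (LinearMap.congr_fun (h.jacobi _ _ _) v)
  · refine fun h => ⟨cobracket_cocycle e r, fun θ η ζ => LinearMap.ext fun v => ?_⟩
    have hzero : 2 * jacobiForm e θ η ζ v r r = 0 := by rw [hjacobi, h v, map_zero]
    exact (mul_eq_zero.1 hzero).resolve_left two_ne_zero

end YangBaxter

theorem equivFun_basis {R M κ : Type*} [CommRing R] [AddCommGroup M] [Module R M] [Finite κ]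
    [DecidableEq κ] (e : Basis κ R M) (i : κ) : e.equivFun (e i) = Pi.single i 1 := by
  ext j
  rw [Basis.equivFun_self, Pi.single_apply]
  exact if_congr eq_comm rfl rfl

section CrossProduct

variable {R M N : Type*} [CommRing R] [AddCommGroup M] [Module R M] [AddCommGroup N] [Module R N]
  (e : Basis (Fin 3) R M)

theorem isAlt_apply_eq_linearCombination_crossProduct {B : M →ₗ[R] M →ₗ[R] N} (hB : B.IsAlt)
    (u v : M) :
    B u v = Fintype.linearCombination R ![B (e 1) (e 2), B (e 2) (e 0), B (e 0) (e 1)]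
      (e.equivFun u ⨯₃ e.equivFun v) := by
  conv_lhs => rw [← e.sum_equivFun u, ← e.sum_equivFun v]
  have hneg (i j : Fin 3) : B (e j) (e i) = -B (e i) (e j) := (hB.neg (e i) (e j)).symm
  simp only [Fin.sum_univ_three, map_add, map_smul, LinearMap.add_apply, LinearMap.smul_apply,
    hB.self_eq_zero, hneg 0 1, hneg 1 2, hneg 2 0, Fintype.linearCombination_apply, cross_apply,
    Matrix.cons_val]
  module

theorem linearCombination_wedge_bijective : Function.Bijective (Fintype.linearCombination R
    ![wedge (R := R) (e 1) (e 2), wedge (e 2) (e 0), wedge (e 0) (e 1)]) := by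
  constructor
  · have hcoord (b : Fin 3 → R) (i j : Fin 3) :
        exteriorPower.pairingDual R M 2 (wedge (e.coord i) (e.coord j))
          (Fintype.linearCombination R
            ![wedge (R := R) (e 1) (e 2), wedge (e 2) (e 0), wedge (e 0) (e 1)] b) =
        (![![0, b 2, -b 1], ![-b 2, 0, b 0], ![b 1, -b 0, 0]] : Fin 3 → Fin 3 → R) i j := by
      simp only [Fintype.linearCombination_apply, Fin.sum_univ_three, map_add, map_smul,
        Matrix.cons_val, pairingDual_wedge_wedge, Basis.coord_apply, Basis.repr_self]
      fin_cases i <;> fin_cases j <;> simp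
    intro b c h
    ext i
    fin_cases i
    · simpa [hcoord] using congrArg
        (exteriorPower.pairingDual R M 2 (wedge (e.coord 1) (e.coord 2))) h
    · simpa [hcoord] using congrArg
        (exteriorPower.pairingDual R M 2 (wedge (e.coord 2) (e.coord 0))) h
    · simpa [hcoord] using congrArg
        (exteriorPower.pairingDual R M 2 (wedge (e.coord 0) (e.coord 1))) h
  · rw [← LinearMap.range_eq_top, eq_top_iff, ← span_wedge, Submodule.span_le]
    rintro _ ⟨⟨u, v⟩, rfl⟩
    exact ⟨_, (isAlt_apply_eq_linearCombination_crossProduct e (fun w => wedge_self w) u v).symm⟩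

/-- The Hodge isomorphism of a based three-dimensional module: it sends `b` to
`b₁ e₂ ∧ e₃ + b₂ e₃ ∧ e₁ + b₃ e₁ ∧ e₂`, so that exterior products become cross products of
coordinate vectors. -/
def hodge : (Fin 3 → R) ≃ₗ[R] ⋀[R]^2 M :=
  LinearEquiv.ofBijective _ (linearCombination_wedge_bijective e)

theorem hodge_apply (b : Fin 3 → R) :
    hodge e b = b 0 • wedge (e 1) (e 2) + b 1 • wedge (e 2) (e 0) + b 2 • wedge (e 0) (e 1) := by
  simp [hodge, Fintype.linearCombination_apply, Fin.sum_univ_three]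

theorem wedge_eq_hodge (u v : M) : wedge u v = hodge e (e.equivFun u ⨯₃ e.equivFun v) :=
  isAlt_apply_eq_linearCombination_crossProduct e (fun w => wedge_self w) u v

end CrossProduct

section AxialVector

variable {R : Type*} [CommRing R]

/-- The axial vector `t` of a matrix `M`, for which `Mᵀ x = M x + t × x`. If `M` is the structure
matrix of a Lie algebra, then `v ↦ t ⬝ v` is the trace of `ad v`. -/
def axialVector (M : Matrix (Fin 3) (Fin 3) R) : Fin 3 → R :=
  ![M 1 2 - M 2 1, M 2 0 - M 0 2, M 0 1 - M 1 0]

theorem axialVector_eq_zero_iff {M : Matrix (Fin 3) (Fin 3) R} :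
    axialVector M = 0 ↔ M.IsSymm := by
  refine ⟨fun h => ?_, fun h => ?_⟩
  · have h₀ : M 1 2 = M 2 1 := sub_eq_zero.1 (congrFun h 0)
    have h₁ : M 2 0 = M 0 2 := sub_eq_zero.1 (congrFun h 1)
    have h₂ : M 0 1 = M 1 0 := sub_eq_zero.1 (congrFun h 2)
    ext i j
    fin_cases i <;> fin_cases j <;> simp [h₀, h₁, h₂]
  · simp [axialVector, h.apply 1 2, h.apply 2 0, h.apply 0 1]

end AxialVector

section StructureMatrix

variable {R L : Type*} [CommRing R] [LieRing L] [LieAlgebra R L] (e : Basis (Fin 3) R L)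

/-- The structure matrix of a three-dimensional Lie algebra: its columns are the coordinates of
`[e₂, e₃]`, `[e₃, e₁]` and `[e₁, e₂]`, so that in coordinates the bracket is `M (x × y)`. -/
def structureMatrix : Matrix (Fin 3) (Fin 3) R :=
  e.toMatrix ![⁅e 1, e 2⁆, ⁅e 2, e 0⁆, ⁅e 0, e 1⁆]

theorem equivFun_lie (u v : L) :
    e.equivFun ⁅u, v⁆ = structureMatrix e *ᵥ (e.equivFun u ⨯₃ e.equivFun v) := by
  let B : L →ₗ[R] L →ₗ[R] L :=
    LinearMap.mk₂ R (fun x y => ⁅x, y⁆) add_lie smul_lie lie_add fun c x y => lie_smul c x y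
  have hlie : ⁅u, v⁆ = Fintype.linearCombination R ![⁅e 1, e 2⁆, ⁅e 2, e 0⁆, ⁅e 0, e 1⁆]
      (e.equivFun u ⨯₃ e.equivFun v) :=
    isAlt_apply_eq_linearCombination_crossProduct e (B := B) (fun w => lie_self w) u v
  rw [hlie]
  ext i
  simp [Fintype.linearCombination_apply, Fin.sum_univ_three, structureMatrix, Matrix.mulVec,
    dotProduct, Basis.toMatrix_apply, mul_comm]

theorem trace_ad (v : L) :
    LinearMap.trace R L (LieAlgebra.ad R L v) =
      axialVector (structureMatrix e) ⬝ᵥ e.equivFun v := by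
  have hdiag (i : Fin 3) : LinearMap.toMatrix e e (LieAlgebra.ad R L v) i i =
      (structureMatrix e *ᵥ (e.equivFun v ⨯₃ Pi.single i 1)) i := by
    rw [LinearMap.toMatrix_apply, LieAlgebra.ad_apply, ← Basis.equivFun_apply, equivFun_lie,
      equivFun_basis]
  rw [LinearMap.trace_eq_matrix_trace R e, Matrix.trace_fin_three, hdiag, hdiag, hdiag]
  simp only [cross_apply, Matrix.mulVec, dotProduct, Fin.sum_univ_three, axialVector,
    Matrix.cons_val, Pi.single_apply, Fin.reduceEq, if_true, if_false]
  ring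

theorem axialVector_vecMul_structureMatrix :
    axialVector (structureMatrix e) ᵥ* structureMatrix e = 0 := by
  have hlie (u v : L) : axialVector (structureMatrix e) ⬝ᵥ e.equivFun ⁅u, v⁆ = 0 := by
    have hcomm : LieAlgebra.ad R L ⁅u, v⁆ =
        LieAlgebra.ad R L u * LieAlgebra.ad R L v - LieAlgebra.ad R L v * LieAlgebra.ad R L u := by
      ext w
      simp
    rw [← trace_ad, hcomm, map_sub, LinearMap.trace_mul_comm, sub_self]
  ext k
  fin_cases k
  exacts [hlie _ _, hlie _ _, hlie _ _]

end StructureMatrix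

theorem eq_zero_of_forall_cross_eq_zero {R : Type*} [CommRing R] {w : Fin 3 → R}
    (h : ∀ x, x ⨯₃ w = 0) : w = 0 := by
  have h₀ := h (Pi.single 0 1)
  have h₁ := h (Pi.single 1 1)
  ext i
  fin_cases i
  · simpa [cross_apply] using congrFun h₁ 2
  · simpa [cross_apply] using congrFun h₀ 2
  · simpa [cross_apply] using congrFun h₁ 0

section Determinant

variable {R M N ι : Type*} [CommRing R] [AddCommGroup M] [Module R M] [AddCommGroup N] [Module R N]
  [Fintype ι] [DecidableEq ι]

theorem alternatingMap_apply_eq_det_smul (f : M [⋀^ι]→ₗ[R] N) (e : Basis ι R M) (w : ι → M) :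
    f w = e.det w • f e := by
  have hf : f = (LinearMap.toSpanSingleton R N (f e)).compAlternatingMap e.det := by
    refine Basis.ext_alternating e fun v hv => ?_
    let σ : Equiv.Perm ι := Equiv.ofBijective v (Finite.injective_iff_bijective.1 hv)
    change f (e ∘ σ) = e.det (e ∘ σ) • f e
    rw [AlternatingMap.map_perm, AlternatingMap.map_perm, Basis.det_self, smul_assoc, one_smul]
  conv_lhs => rw [hf]
  rfl

end Determinant

section Table

variable {L : Type*} [LieRing L] [LieAlgebra ℝ L] (e : Basis (Fin 3) ℝ L)

theorem ιMulti_eq_smul_e123 (u v w : L) :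
    exteriorPower.ιMulti ℝ 3 ![u, v, w] =
      (e.equivFun u ⬝ᵥ e.equivFun v ⨯₃ e.equivFun w) • e123 e := by
  have he : ⇑e = ![e 0, e 1, e 2] := List.ofFn_injective rfl
  rw [alternatingMap_apply_eq_det_smul _ e, e123, ← he, Basis.det_apply, Matrix.det_fin_three]
  congr 1
  simp only [Basis.toMatrix_apply, Basis.equivFun_apply, cross_apply, dotProduct,
    Fin.sum_univ_three, Matrix.cons_val]
  ring

theorem span_e123 : Submodule.span ℝ {e123 e} = ⊤ := by
  rw [eq_top_iff, ← exteriorPower.ιMulti_span ℝ 3 L, Submodule.span_le]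
  rintro _ ⟨w, rfl⟩
  have hw : w = ![w 0, w 1, w 2] := List.ofFn_injective rfl
  rw [hw, ιMulti_eq_smul_e123 e]
  exact Submodule.smul_mem _ _ (Submodule.mem_span_singleton_self _)

theorem e123_ne_zero : e123 e ≠ 0 := by
  have he : ⇑e = ![e 0, e 1, e 2] := List.ofFn_injective rfl
  intro h
  have hdet := congrArg (exteriorPower.alternatingMapLinearEquiv e.det) h
  rw [e123, exteriorPower.alternatingMapLinearEquiv_apply_ιMulti, ← he, Basis.det_self,
    map_zero] at hdet
  exact one_ne_zero hdet

theorem cobracket_hodge (b : Fin 3 → ℝ) (v : L) :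
    cobracket e (hodge e b) v = hodge e
      (e.equivFun v ⨯₃ (structureMatrix e *ᵥ b) +
        (e.equivFun v ⬝ᵥ b) • axialVector (structureMatrix e)) := by
  simp only [hodge_apply e b, cobracket_add, cobracket_smul, LinearMap.add_apply,
    LinearMap.smul_apply, cobracket_wedge]
  simp only [wedge_eq_hodge e, equivFun_lie, equivFun_basis, ← map_add, ← map_smul]
  congr 1
  ext i
  fin_cases i <;>
    simp [cross_apply, Matrix.mulVec, dotProduct, Fin.sum_univ_three, axialVector] <;> ring

theorem schoutenSq_hodge (b : Fin 3 → ℝ) :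
    schoutenSq e (hodge e b) = (2 * (b ⬝ᵥ structureMatrix e *ᵥ b)) • e123 e := by
  simp only [schoutenSq, hodge_apply, map_add, map_smul, LinearMap.add_apply, LinearMap.smul_apply,
    schouten_wedge_wedge, ιMulti_eq_smul_e123 e, equivFun_lie, equivFun_basis]
  simp only [cross_apply, Matrix.mulVec, dotProduct, Fin.sum_univ_three, Pi.single_apply,
    Matrix.cons_val, Fin.isValue, Fin.reduceEq, if_true, if_false]
  module

theorem schouten_vec_e123 (v : L) :
    schouten e 0 2 (vec v) (e123 e) =
      (axialVector (structureMatrix e) ⬝ᵥ e.equivFun v) • e123 e := by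
  rw [e123, schouten_vec_ιMulti_three]
  simp only [ιMulti_eq_smul_e123 e, equivFun_lie, equivFun_basis]
  simp only [cross_apply, Matrix.mulVec, dotProduct, Fin.sum_univ_three, Pi.single_apply,
    Matrix.cons_val, Fin.isValue, Fin.reduceEq, if_true, if_false, axialVector, Nat.succ_eq_add_one]
  module

theorem hodge_mem_inv2_iff {b : Fin 3 → ℝ} : hodge e b ∈ inv2 e ↔
    ∀ x : Fin 3 → ℝ, x ⨯₃ (structureMatrix e *ᵥ b) +
      (x ⬝ᵥ b) • axialVector (structureMatrix e) = 0 := by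
  rw [mem_inv2_iff, LinearMap.ext_iff, e.equivFun.surjective.forall]
  simp only [cobracket_hodge, LinearMap.zero_apply, LinearEquiv.map_eq_zero_iff]

section Unimodular

variable {e}

theorem hodge_mem_inv2_iff_of_unimodular (ht : axialVector (structureMatrix e) = 0)
    {b : Fin 3 → ℝ} : hodge e b ∈ inv2 e ↔ structureMatrix e *ᵥ b = 0 := by
  simp only [hodge_mem_inv2_iff, ht, smul_zero, add_zero]
  refine ⟨fun h => ?_, fun h x => by rw [h, map_zero]⟩
  exact eq_zero_of_forall_cross_eq_zero h

theorem inv2_eq_bot_of_not_unimodular (ht : axialVector (structureMatrix e) ≠ 0) : inv2 e = ⊥ := by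
  refine (Submodule.eq_bot_iff _).2 fun r hr => ?_
  obtain ⟨b, rfl⟩ := (hodge e).surjective r
  rw [hodge_mem_inv2_iff] at hr
  set t := axialVector (structureMatrix e)
  set u := structureMatrix e *ᵥ b
  have htt : t ⬝ᵥ t ≠ 0 := fun h => ht (dotProduct_self_eq_zero.1 h)
  have htb : t ⬝ᵥ b = 0 := by
    have h : t ⬝ᵥ (t ⨯₃ u + (t ⬝ᵥ b) • t) = 0 := by rw [hr t, dotProduct_zero]
    rw [dotProduct_add, dot_self_cross, zero_add, dotProduct_smul, smul_eq_mul] at h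
    exact (mul_eq_zero.1 h).resolve_right htt
  have htu : t ⨯₃ u = 0 := by simpa only [htb, zero_smul, add_zero] using hr t
  have hb : b ⬝ᵥ b = 0 := by
    have h : t ⬝ᵥ (b ⨯₃ u + (b ⬝ᵥ b) • t) = 0 := by rw [hr b, dotProduct_zero]
    rw [dotProduct_add, triple_product_permutation, ← cross_anticomm, htu, neg_zero,
      dotProduct_zero, zero_add, dotProduct_smul, smul_eq_mul] at h
    exact (mul_eq_zero.1 h).resolve_right htt
  rw [dotProduct_self_eq_zero.1 hb, map_zero]

theorem inv3_eq_top_of_unimodular (ht : axialVector (structureMatrix e) = 0) : inv3 e = ⊤ := by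
  rw [eq_top_iff, ← span_e123 e, Submodule.span_singleton_le_iff_mem]
  intro v
  rw [schouten_vec_e123, ht, zero_dotProduct, zero_smul]

theorem inv3_eq_bot_of_not_unimodular (ht : axialVector (structureMatrix e) ≠ 0) :
    inv3 e = ⊥ := by
  refine (Submodule.eq_bot_iff _).2 fun w hw => ?_
  obtain ⟨c, rfl⟩ := Submodule.mem_span_singleton.1 ((span_e123 e).ge (Submodule.mem_top (x := w)))
  have hinv := hw (e.equivFun.symm (axialVector (structureMatrix e)))
  rw [map_smul, schouten_vec_e123, LinearEquiv.apply_symm_apply, smul_smul] at hinv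
  have hc := (smul_eq_zero.1 hinv).resolve_right (e123_ne_zero e)
  rw [(mul_eq_zero.1 hc).resolve_right fun h => ht (dotProduct_self_eq_zero.1 h), zero_smul]

theorem mcybe_hodge_iff {b : Fin 3 → ℝ} : MCYBE e (hodge e b) ↔
    axialVector (structureMatrix e) = 0 ∨ b ⬝ᵥ structureMatrix e *ᵥ b = 0 := by
  by_cases ht : axialVector (structureMatrix e) = 0
  · simp [MCYBE, inv3_eq_top_of_unimodular ht, ht]
  · simp [MCYBE, inv3_eq_bot_of_not_unimodular ht, ht, schoutenSq_hodge, e123_ne_zero]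

end Unimodular

end Table

section ChangeOfBasis

variable {R : Type*} [CommRing R]

theorem mulVec_cross_mulVec (Q : Matrix (Fin 3) (Fin 3) R) (x y : Fin 3 → R) :
    (Q *ᵥ x) ⨯₃ (Q *ᵥ y) = Q.adjugateᵀ *ᵥ (x ⨯₃ y) := by
  ext i
  fin_cases i <;>
    simp [cross_apply, Matrix.mulVec, dotProduct, Fin.sum_univ_three, Matrix.adjugate_fin_three] <;>
    ring

theorem ext_of_mulVec_cross {A B : Matrix (Fin 3) (Fin 3) R}
    (h : ∀ x y, A *ᵥ (x ⨯₃ y) = B *ᵥ (x ⨯₃ y)) : A = B := by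
  refine Matrix.ext_of_mulVec_single fun i => ?_
  have hcross : Pi.single (i + 1) 1 ⨯₃ Pi.single (i + 2) 1 = (Pi.single i 1 : Fin 3 → R) := by
    ext k
    fin_cases i <;> fin_cases k <;> simp [cross_apply]
  rw [← hcross, h]

theorem toMatrix_map_toLinearEquiv {M ι : Type*} [AddCommGroup M] [Module R M] [Fintype ι]
    [DecidableEq ι] (e : Basis ι R M) {Q : Matrix ι ι R} (hQ : IsUnit Q.det) :
    e.toMatrix (e.map (Q.toLinearEquiv e hQ)) = Q := by
  ext i j
  change e.repr (Matrix.toLin e e Q (e j)) i = Q i j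
  rw [← LinearMap.toMatrix_apply, LinearMap.toMatrix_toLin]

section Hodge

variable {M N : Type*} [AddCommGroup M] [Module R M] [AddCommGroup N] [Module R N]

theorem toMatrix_mulVec_equivFun (e f : Basis (Fin 3) R M) (v : M) :
    e.toMatrix f *ᵥ f.equivFun v = e.equivFun v :=
  f.toMatrix_mulVec_repr e v

theorem hodge_eq_hodge_adjugate (e f : Basis (Fin 3) R M) (b : Fin 3 → R) :
    hodge f b = hodge e ((e.toMatrix f).adjugateᵀ *ᵥ b) := by
  have hcomp : ((hodge e).toLinearMap ∘ₗ (e.toMatrix f).adjugateᵀ.mulVecLin) ∘ₗ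
      (hodge f).symm.toLinearMap = LinearMap.id := by
    refine linearMap_ext_wedge fun u v => ?_
    rw [LinearMap.comp_apply, wedge_eq_hodge f, LinearEquiv.coe_coe, LinearEquiv.symm_apply_apply,
      LinearMap.comp_apply, Matrix.mulVecLin_apply, ← mulVec_cross_mulVec,
      toMatrix_mulVec_equivFun, toMatrix_mulVec_equivFun, LinearEquiv.coe_coe, ← wedge_eq_hodge e,
      ← wedge_eq_hodge f, LinearMap.id_apply]
  simpa only [LinearMap.comp_apply, LinearEquiv.coe_coe, LinearEquiv.symm_apply_apply,
    Matrix.mulVecLin_apply, LinearMap.id_apply] using (LinearMap.congr_fun hcomp (hodge f b)).symm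

theorem map_hodge (e : Basis (Fin 3) R M) (T : M ≃ₗ[R] N) (b : Fin 3 → R) :
    exteriorPower.map 2 T.toLinearMap (hodge e b) = hodge (e.map T) b := by
  simp [hodge_apply, map_wedge]

end Hodge

variable {L L' : Type*} [LieRing L] [LieAlgebra R L] [LieRing L'] [LieAlgebra R L']

theorem toMatrix_mul_structureMatrix (e f : Basis (Fin 3) R L) :
    e.toMatrix f * structureMatrix f = structureMatrix e * (e.toMatrix f).adjugateᵀ := by
  refine ext_of_mulVec_cross fun x y => ?_
  obtain ⟨u, rfl⟩ := f.equivFun.surjective x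
  obtain ⟨v, rfl⟩ := f.equivFun.surjective y
  rw [← Matrix.mulVec_mulVec, ← Matrix.mulVec_mulVec, ← equivFun_lie, ← mulVec_cross_mulVec,
    toMatrix_mulVec_equivFun, toMatrix_mulVec_equivFun, toMatrix_mulVec_equivFun, equivFun_lie]

theorem structureMatrix_eq_iff (e f : Basis (Fin 3) R L) {N : Matrix (Fin 3) (Fin 3) R} :
    structureMatrix f = N ↔
      e.toMatrix f * N * (e.toMatrix f)ᵀ = (e.toMatrix f).det • structureMatrix e := by
  have hf : e.toMatrix f * structureMatrix f * (e.toMatrix f)ᵀ =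
      (e.toMatrix f).det • structureMatrix e := by
    rw [toMatrix_mul_structureMatrix, Matrix.mul_assoc, ← Matrix.transpose_mul,
      Matrix.mul_adjugate, Matrix.transpose_smul, Matrix.transpose_one, Matrix.mul_smul,
      Matrix.mul_one]
  have hQ : IsUnit (e.toMatrix f) := (Matrix.isUnit_iff_isUnit_det _).2 (e.isUnit_det f)
  rw [← hf, ((Matrix.isUnit_transpose _).2 hQ).mul_left_inj, hQ.mul_right_inj, eq_comm]

theorem axialVector_structureMatrix_vecMul (e f : Basis (Fin 3) R L) :
    axialVector (structureMatrix e) ᵥ* e.toMatrix f = axialVector (structureMatrix f) := by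
  refine dotProduct_eq _ _ fun x => ?_
  obtain ⟨v, rfl⟩ := f.equivFun.surjective x
  rw [← Matrix.dotProduct_mulVec, toMatrix_mulVec_equivFun, ← trace_ad, ← trace_ad]

theorem structureMatrix_map (e : Basis (Fin 3) R L) (T : L ≃ₗ⁅R⁆ L') :
    structureMatrix (e.map T.toLinearEquiv) = structureMatrix e := by
  refine ext_of_mulVec_cross fun x y => ?_
  obtain ⟨u, rfl⟩ := e.equivFun.surjective x
  obtain ⟨v, rfl⟩ := e.equivFun.surjective y
  have hT (w : L) : e.equivFun w = (e.map T.toLinearEquiv).equivFun (T w) := by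
    ext i
    exact congrArg (fun u => e.repr u i) (T.symm_apply_apply w).symm
  rw [← equivFun_lie, hT, hT, hT, ← equivFun_lie, LieEquiv.map_lie]

/-- The isomorphism of Lie algebras that maps a basis to a basis with the same structure matrix. -/
def lieEquivOfStructureMatrix (e : Basis (Fin 3) R L) (f : Basis (Fin 3) R L')
    (h : structureMatrix e = structureMatrix f) : L ≃ₗ⁅R⁆ L' :=
  { e.equivFun.trans f.equivFun.symm with
    map_lie' := fun {u v} => by
      have hcoord (w : L) : f.equivFun ((e.equivFun.trans f.equivFun.symm) w) = e.equivFun w :=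
        f.equivFun.apply_symm_apply _
      refine f.equivFun.injective ((hcoord ⁅u, v⁆).trans ?_)
      rw [equivFun_lie, equivFun_lie, ← h, ← hcoord u, ← hcoord v]
      rfl }

theorem map_lieEquivOfStructureMatrix (e : Basis (Fin 3) R L) (f : Basis (Fin 3) R L')
    (h : structureMatrix e = structureMatrix f) :
    e.map (lieEquivOfStructureMatrix e f h).toLinearEquiv = f := by
  ext i
  exact f.equivFun.symm_apply_eq.2 ((equivFun_basis e i).trans (equivFun_basis f i).symm)

end ChangeOfBasis

section Automorphisms

variable {L : Type*} [LieRing L] [LieAlgebra ℝ L] {e : Basis (Fin 3) ℝ L}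

/-- `Q` is the matrix of an automorphism of a three-dimensional Lie algebra with structure
matrix `M`. -/
structure IsAutomorphismMatrix (M Q : Matrix (Fin 3) (Fin 3) ℝ) : Prop where
  det_ne_zero : Q.det ≠ 0
  mul_mul_transpose : Q * M * Qᵀ = Q.det • M

theorem isAutomorphismMatrix_toMatrix_map (T : L ≃ₗ⁅ℝ⁆ L) :
    IsAutomorphismMatrix (structureMatrix e) (e.toMatrix (e.map T.toLinearEquiv)) :=
  ⟨(e.isUnit_det _).ne_zero, (structureMatrix_eq_iff e _).1 (structureMatrix_map e T)⟩

theorem IsAutomorphismMatrix.exists_lieEquiv {Q : Matrix (Fin 3) (Fin 3) ℝ}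
    (hQ : IsAutomorphismMatrix (structureMatrix e) Q) :
    ∃ T : L ≃ₗ⁅ℝ⁆ L, e.toMatrix (e.map T.toLinearEquiv) = Q := by
  let f := e.map (Q.toLinearEquiv e hQ.det_ne_zero.isUnit)
  have hf : e.toMatrix f = Q := toMatrix_map_toLinearEquiv e hQ.det_ne_zero.isUnit
  have hstructure : structureMatrix f = structureMatrix e :=
    (structureMatrix_eq_iff e f).2 (by rw [hf, hQ.mul_mul_transpose])
  exact ⟨lieEquivOfStructureMatrix e f hstructure.symm, by rw [map_lieEquivOfStructureMatrix, hf]⟩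

theorem IsAutomorphismMatrix.axialVector_vecMul {Q : Matrix (Fin 3) (Fin 3) ℝ}
    (hQ : IsAutomorphismMatrix (structureMatrix e) Q) :
    axialVector (structureMatrix e) ᵥ* Q = axialVector (structureMatrix e) := by
  obtain ⟨T, rfl⟩ := hQ.exists_lieEquiv
  rw [axialVector_structureMatrix_vecMul, structureMatrix_map]

theorem reducedEquiv_hodge_iff {b c : Fin 3 → ℝ} :
    ReducedEquiv e (hodge e b) (hodge e c) ↔
      ∃ Q c', IsAutomorphismMatrix (structureMatrix e) Q ∧ c' ᵥ* Q = Q.det • b ∧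
        hodge e (c' - c) ∈ inv2 e := by
  have hmap (T : L ≃ₗ⁅ℝ⁆ L) : mapTwo T (hodge e b) = hodge e
      (b ᵥ* (e.toMatrix (e.map T.toLinearEquiv)).adjugate) := by
    rw [← Matrix.mulVec_transpose, ← hodge_eq_hodge_adjugate]
    exact map_hodge e T.toLinearEquiv b
  simp only [ReducedEquiv, hmap, Submodule.mkQ_apply, Submodule.Quotient.eq, ← map_sub]
  constructor
  · rintro ⟨T, hT⟩
    refine ⟨_, _, isAutomorphismMatrix_toMatrix_map T, ?_, hT⟩
    rw [Matrix.vecMul_vecMul, Matrix.adjugate_mul, Matrix.vecMul_smul, Matrix.vecMul_one]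
  · rintro ⟨Q, c', hQ, hc', hinv⟩
    obtain ⟨T, rfl⟩ := hQ.exists_lieEquiv
    refine ⟨T, ?_⟩
    have hadj := congrArg (· ᵥ* (e.toMatrix (e.map T.toLinearEquiv)).adjugate) hc'
    simp only [Matrix.vecMul_vecMul, Matrix.mul_adjugate, Matrix.vecMul_smul, Matrix.vecMul_one,
      Matrix.smul_vecMul] at hadj
    rwa [← smul_right_injective _ hQ.det_ne_zero hadj]

end Automorphisms

section Locus

variable {L : Type*} [LieRing L] [LieAlgebra ℝ L] (e : Basis (Fin 3) ℝ L)

theorem bivec_eq_hodge (x y z : ℝ) : bivec e x y z = hodge e ![z, -y, x] := by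
  have h13 : e13 e = -wedge (e 2) (e 0) := by rw [← wedge_swap, wedge_apply, e13]
  have h12 : e12 e = wedge (e 0) (e 1) := rfl
  have h23 : e23 e = wedge (e 1) (e 2) := rfl
  rw [hodge_apply, bivec, h12, h13, h23]
  simp only [Matrix.cons_val]
  module

theorem exists_bivec (r : ⋀[ℝ]^2 L) : ∃ x y z, r = bivec e x y z := by
  obtain ⟨b, rfl⟩ := (hodge e).surjective r
  refine ⟨b 2, -b 1, b 0, ?_⟩
  rw [bivec_eq_hodge, neg_neg]
  exact congrArg (hodge e) (List.ofFn_injective rfl)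

variable {e}

theorem bivec_inj {x y z x' y' z' : ℝ} :
    bivec e x y z = bivec e x' y' z' ↔ x = x' ∧ y = y' ∧ z = z' := by
  rw [bivec_eq_hodge, bivec_eq_hodge, (hodge e).injective.eq_iff]
  refine ⟨fun h => ⟨congrFun h 2, neg_injective (congrFun h 1), congrFun h 0⟩, ?_⟩
  rintro ⟨rfl, rfl, rfl⟩
  rfl

theorem bivec_mem_locus_iff {P : ℝ → ℝ → ℝ → Prop} {x y z : ℝ} :
    bivec e x y z ∈ locus e P ↔ P x y z := by
  refine ⟨?_, fun h => ⟨x, y, z, h, rfl⟩⟩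
  rintro ⟨x', y', z', h, heq⟩
  obtain ⟨rfl, rfl, rfl⟩ := bivec_inj.1 heq
  exact h

theorem bivec_mem_span_e23_iff {x y z : ℝ} :
    bivec e x y z ∈ Submodule.span ℝ {e23 e} ↔ x = 0 ∧ y = 0 := by
  have h (a : ℝ) : a • e23 e = bivec e 0 0 a := by simp [bivec]
  simp [Submodule.mem_span_singleton, h, bivec_inj, eq_comm]

theorem bivec_mem_span_e13_e23_iff {x y z : ℝ} :
    bivec e x y z ∈ Submodule.span ℝ {e13 e, e23 e} ↔ x = 0 := by
  have h (a b : ℝ) : a • e13 e + b • e23 e = bivec e 0 a b := by simp [bivec]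
  simp [Submodule.mem_span_pair, h, bivec_inj, eq_comm]

theorem bivec_eq_zero_iff {x y z : ℝ} : bivec e x y z = 0 ↔ x = 0 ∧ y = 0 ∧ z = 0 := by
  have h : bivec e 0 0 0 = 0 := by simp [bivec]
  rw [← h, bivec_inj]

theorem setOf_eq_locus {p : ⋀[ℝ]^2 L → Prop} {P : ℝ → ℝ → ℝ → Prop}
    (h : ∀ x y z, p (bivec e x y z) ↔ P x y z) : {r | p r} = locus e P := by
  ext r
  obtain ⟨x, y, z, rfl⟩ := exists_bivec e r
  rw [bivec_mem_locus_iff, ← h]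
  rfl

end Locus

section Classification

variable {L : Type*} [LieRing L] [LieAlgebra ℝ L] {e : Basis (Fin 3) ℝ L}
  {ι : Type*} {P : ι → ℝ → ℝ → ℝ → Prop} {ρ : ι → ⋀[ℝ]^2 L} {i : ι} {r : ⋀[ℝ]^2 L}

/-- The loci `P i` contain the r-matrices with a nonzero cocommutator and nothing else, and each of
them consists of elements equivalent to its member `ρ i`, where the `ρ i` are inequivalent. -/
structure IsClassification (e : Basis (Fin 3) ℝ L) (P : ι → ℝ → ℝ → ℝ → Prop)
    (ρ : ι → ⋀[ℝ]^2 L) : Prop where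
  exists_iff : ∀ x y z, (∃ i, P i x y z) ↔ MCYBE e (bivec e x y z) ∧ bivec e x y z ∉ inv2 e
  rep_mem : ∀ i, ρ i ∈ locus e (P i)
  reducedEquiv_rep : ∀ i x y z, P i x y z → ReducedEquiv e (bivec e x y z) (ρ i)
  eq_of_reducedEquiv : ∀ i j, ReducedEquiv e (ρ i) (ρ j) → i = j

namespace IsClassification

theorem exists_mem_locus_iff (h : IsClassification e P ρ) :
    (∃ i, r ∈ locus e (P i)) ↔ IsRMatrix e r ∧ cobracket e r ≠ 0 := by
  obtain ⟨x, y, z, rfl⟩ := exists_bivec e r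
  simp only [bivec_mem_locus_iff, h.exists_iff, isRMatrix_iff_mcybe, mem_inv2_iff, ne_eq]

theorem cocommutatorEquiv_rep (h : IsClassification e P ρ) (hr : r ∈ locus e (P i)) :
    CocommutatorEquiv (cobracket e r) (cobracket e (ρ i)) := by
  obtain ⟨x, y, z, hP, rfl⟩ := hr
  exact cocommutatorEquiv_iff_reducedEquiv.2 (h.reducedEquiv_rep i x y z hP)

theorem rClass_eq_locus (h : IsClassification e P ρ) (hr : r ∈ locus e (P i)) :
    rClass e r = locus e (P i) := by
  have hne : cobracket e r ≠ 0 := (h.exists_mem_locus_iff.1 ⟨i, hr⟩).2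
  ext s
  constructor
  · rintro ⟨hs, hrs⟩
    obtain ⟨j, hj⟩ := h.exists_mem_locus_iff.2 ⟨hs, hrs.ne_zero hne⟩
    have hij : i = j := h.eq_of_reducedEquiv i j <| cocommutatorEquiv_iff_reducedEquiv.1 <|
      (h.cocommutatorEquiv_rep hr).symm.trans (hrs.trans (h.cocommutatorEquiv_rep hj))
    rwa [hij]
  · exact fun hs => ⟨(h.exists_mem_locus_iff.1 ⟨i, hs⟩).1,
      (h.cocommutatorEquiv_rep hr).trans (h.cocommutatorEquiv_rep hs).symm⟩

theorem isRMatrix_rep (h : IsClassification e P ρ) (i : ι) :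
    IsRMatrix e (ρ i) ∧ cobracket e (ρ i) ≠ 0 :=
  h.exists_mem_locus_iff.1 ⟨i, h.rep_mem i⟩

theorem nonzeroClasses_eq (h : IsClassification e P ρ) :
    nonzeroClasses e = Set.range fun i => locus e (P i) := by
  ext C
  constructor
  · rintro ⟨r, hr, hne, rfl⟩
    obtain ⟨i, hi⟩ := h.exists_mem_locus_iff.2 ⟨hr, hne⟩
    exact ⟨i, (h.rClass_eq_locus hi).symm⟩
  · rintro ⟨i, rfl⟩
    exact ⟨ρ i, (h.isRMatrix_rep i).1, (h.isRMatrix_rep i).2,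
      (h.rClass_eq_locus (h.rep_mem i)).symm⟩

theorem existsUnique_rep (h : IsClassification e P ρ) {δ : L →ₗ[ℝ] ⋀[ℝ]^2 L}
    (hδ : IsCoboundary e δ) (hne : δ ≠ 0) :
    ∃! r, r ∈ Set.range ρ ∧ CocommutatorEquiv δ (cobracket e r) := by
  obtain ⟨hr, r, rfl⟩ := hδ
  obtain ⟨i, hi⟩ := h.exists_mem_locus_iff.2 ⟨hr, hne⟩
  refine ⟨ρ i, ⟨⟨i, rfl⟩, h.cocommutatorEquiv_rep hi⟩, ?_⟩
  rintro _ ⟨⟨j, rfl⟩, hj⟩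
  rw [h.eq_of_reducedEquiv i j <| cocommutatorEquiv_iff_reducedEquiv.1 <|
    (h.cocommutatorEquiv_rep hi).symm.trans hj]

end IsClassification

end Classification

theorem structureMatrix_eq_iff_lie {R L : Type*} [CommRing R] [LieRing L] [LieAlgebra R L]
    {e : Basis (Fin 3) R L} {N : Matrix (Fin 3) (Fin 3) R} :
    structureMatrix e = N ↔
      ⁅e 0, e 1⁆ = N 0 2 • e 0 + N 1 2 • e 1 + N 2 2 • e 2 ∧
      ⁅e 0, e 2⁆ = -(N 0 1 • e 0 + N 1 1 • e 1 + N 2 1 • e 2) ∧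
      ⁅e 2, e 1⁆ = -(N 0 0 • e 0 + N 1 0 • e 1 + N 2 0 • e 2) := by
  have hcol (v : L) (c : Fin 3 → R) :
      e.equivFun v = c ↔ v = c 0 • e 0 + c 1 • e 1 + c 2 • e 2 := by
    rw [← e.equivFun.eq_symm_apply, e.equivFun_symm_apply, Fin.sum_univ_three]
  have hstructure : structureMatrix e = N ↔ e.equivFun ⁅e 0, e 1⁆ = N.col 2 ∧
      e.equivFun ⁅e 2, e 0⁆ = N.col 1 ∧ e.equivFun ⁅e 1, e 2⁆ = N.col 0 := by
    refine ⟨by rintro rfl; exact ⟨rfl, rfl, rfl⟩, fun ⟨h₂, h₁, h₀⟩ => ?_⟩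
    ext i j
    fin_cases j
    exacts [congrFun h₀ i, congrFun h₁ i, congrFun h₂ i]
  rw [hstructure, hcol, hcol, hcol, ← lie_skew (e 0) (e 2), ← lie_skew (e 2) (e 1), neg_inj,
    neg_inj]
  rfl

/-- The structure matrix of a row of the table. -/
def Row.matrix (t : Row) : Matrix (Fin 3) (Fin 3) ℝ :=
  match t with
  | .sl2 => !![1, 0, 0; 0, 0, 1; 0, 1, 0]
  | .su2 => !![1, 0, 0; 0, 1, 0; 0, 0, 1]
  | .heis => !![0, 0, 0; 0, 0, 0; 0, 0, 1]
  | .r30' => !![0, 0, 0; 0, -1, 0; 0, 0, -1]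
  | .r3m1 => !![0, 0, 0; 0, 0, 1; 0, 1, 0]
  | .r31 => !![0, 0, 0; 0, 0, 1; 0, -1, 0]
  | .r3 => !![-1, 1, 0; -1, 0, 0; 0, 0, 0]
  | .r3l l _ => !![0, 1, 0; -l, 0, 0; 0, 0, 0]
  | .r3l' l _ => !![-1, l, 0; -l, -1, 0; 0, 0, 0]

/-- The rows whose adjoint maps are traceless. -/
def Row.IsUnimodular (t : Row) : Prop :=
  match t with
  | .sl2 | .su2 | .heis | .r30' | .r3m1 => True
  | _ => False

section Table

variable {L : Type*} [LieRing L] [LieAlgebra ℝ L] {e : Basis (Fin 3) ℝ L} (t : Row)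

theorem Row.relations_iff : t.Relations e ↔ structureMatrix e = t.matrix := by
  rw [structureMatrix_eq_iff_lie]
  cases t <;> simp [Row.matrix, Row.Relations, sub_eq_add_neg, add_comm (e 1) (e 0)]

theorem Row.axialVector_matrix_eq_zero_iff : axialVector t.matrix = 0 ↔ t.IsUnimodular := by
  cases t with
  | r3l l hl =>
    have hl' : 1 + l ≠ 0 := by linarith [hl.1]
    simp [Row.matrix, axialVector, Row.IsUnimodular, hl']
  | r3l' l hl =>
    have hl' : l + l ≠ 0 := by rwa [← two_mul, mul_ne_zero_iff_left two_ne_zero]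
    simp [Row.matrix, axialVector, Row.IsUnimodular, hl']
  | _ => simp [Row.matrix, axialVector, Row.IsUnimodular]

variable {t} (h : structureMatrix e = t.matrix)
include h

theorem Row.inv2_eq : CoboundaryLie.inv2 e = t.inv2 e := by
  by_cases ht : t.IsUnimodular
  · ext r
    obtain ⟨x, y, z, rfl⟩ := exists_bivec e r
    have hmem : bivec e x y z ∈ CoboundaryLie.inv2 e ↔ t.matrix *ᵥ ![z, -y, x] = 0 := by
      rw [bivec_eq_hodge,
        hodge_mem_inv2_iff_of_unimodular (h ▸ t.axialVector_matrix_eq_zero_iff.2 ht), h]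
    rw [hmem]
    cases t <;> first
      | exact ht.elim
      | simp [Row.matrix, Row.inv2, bivec_mem_span_e23_iff, bivec_mem_span_e13_e23_iff,
          bivec_eq_zero_iff, funext_iff, Fin.forall_fin_succ, and_comm, and_assoc]
  · rw [inv2_eq_bot_of_not_unimodular (h ▸ t.axialVector_matrix_eq_zero_iff.not.2 ht)]
    cases t <;> simp_all [Row.inv2, Row.IsUnimodular]

theorem Row.inv3_eq : CoboundaryLie.inv3 e = t.inv3 L := by
  by_cases ht : t.IsUnimodular
  · rw [inv3_eq_top_of_unimodular (h ▸ t.axialVector_matrix_eq_zero_iff.2 ht)]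
    cases t <;> simp_all [Row.inv3, Row.IsUnimodular]
  · rw [inv3_eq_bot_of_not_unimodular (h ▸ t.axialVector_matrix_eq_zero_iff.not.2 ht)]
    cases t <;> simp_all [Row.inv3, Row.IsUnimodular]

theorem Row.schoutenSq_bivec (x y z : ℝ) :
    schoutenSq e (bivec e x y z) = t.schoutenCoeff x y z • e123 e := by
  rw [bivec_eq_hodge, schoutenSq_hodge, h]
  congr 1
  cases t <;>
    simp only [Row.matrix, Row.schoutenCoeff, Matrix.mulVec, dotProduct, Fin.sum_univ_three,
      Matrix.of_apply, Matrix.cons_val] <;>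
    ring

theorem Row.mcybe_iff (x y z : ℝ) : MCYBE e (bivec e x y z) ↔ t.YB x y z := by
  have hcoeff : MCYBE e (bivec e x y z) ↔ t.IsUnimodular ∨ t.schoutenCoeff x y z = 0 := by
    rw [← smul_eq_zero_iff_left (e123_ne_zero e), ← Row.schoutenSq_bivec h,
      ← t.axialVector_matrix_eq_zero_iff, ← h, bivec_eq_hodge, mcybe_hodge_iff, schoutenSq_hodge,
      smul_eq_zero_iff_left (e123_ne_zero e), mul_eq_zero_iff_left two_ne_zero]
  rw [hcoeff]
  cases t with
  | r3l l hl =>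
    have hl' : l - 1 ≠ 0 := by linarith [hl.2]
    simp [Row.schoutenCoeff, Row.YB, Row.IsUnimodular, hl']
  | r3l' l hl =>
    simp [Row.schoutenCoeff, Row.YB, Row.IsUnimodular,
      add_eq_zero_iff_of_nonneg (sq_nonneg y) (sq_nonneg z)]
  | _ => simp [Row.schoutenCoeff, Row.YB, Row.IsUnimodular]

end Table

section Equivalence

variable {L : Type*} [LieRing L] [LieAlgebra ℝ L] {e : Basis (Fin 3) ℝ L}
  {M Q : Matrix (Fin 3) (Fin 3) ℝ} {b c : Fin 3 → ℝ} {x y z x' y' z' : ℝ}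

theorem reducedEquiv_bivec_of_matrix (h : structureMatrix e = M) {d : ℝ} (hdet : Q.det = d)
    (hd : d ≠ 0) (hM : Q * M * Qᵀ = d • M) (hv : ![z', -y', x'] ᵥ* Q = d • ![z, -y, x]) :
    ReducedEquiv e (bivec e x y z) (bivec e x' y' z') := by
  subst h hdet
  rw [bivec_eq_hodge, bivec_eq_hodge, reducedEquiv_hodge_iff]
  exact ⟨Q, _, ⟨hd, hM⟩, hv, by simp⟩

theorem reducedEquiv_bivec_sq_mul (h : structureMatrix e = M) (hrow : M 2 = 0) (hcol : M.col 2 = 0)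
    {a : ℝ} (ha : a ≠ 0) (x : ℝ) : ReducedEquiv e (bivec e x 0 0) (bivec e (a ^ 2 * x) 0 0) := by
  have hrow' (j : Fin 3) : M 2 j = 0 := congrFun hrow j
  have hcol' (i : Fin 3) : M i 2 = 0 := congrFun hcol i
  refine reducedEquiv_bivec_of_matrix (Q := .diagonal ![a, a, 1]) (d := a ^ 2) h ?_
    (pow_ne_zero 2 ha) ?_ ?_
  · simp [Fin.prod_univ_three, sq]
  · ext i j
    fin_cases i <;> fin_cases j <;> simp [hrow', hcol'] <;> ring
  · ext i
    fin_cases i <;> simp [Matrix.vecMul_diagonal, mul_comm]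

theorem ReducedEquiv.exists_isAutomorphismMatrix_vecMul (h : structureMatrix e = M)
    (ht : axialVector M ≠ 0) (hr : ReducedEquiv e (bivec e x y z) (bivec e x' y' z')) :
    ∃ Q, IsAutomorphismMatrix M Q ∧ ![z', -y', x'] ᵥ* Q = Q.det • ![z, -y, x] := by
  subst h
  rw [bivec_eq_hodge, bivec_eq_hodge, reducedEquiv_hodge_iff, inv2_eq_bot_of_not_unimodular ht]
    at hr
  obtain ⟨Q, c', hQ, hv, hc⟩ := hr
  rw [Submodule.mem_bot, LinearEquiv.map_eq_zero_iff, sub_eq_zero] at hc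
  exact ⟨Q, hQ, hc ▸ hv⟩

theorem ReducedEquiv.exists_eq_det_smul_of_axialVector_eq_smul (h : structureMatrix e = M)
    {s : ℝ} (hs : s ≠ 0) (ht : axialVector M = s • ![z', -y', x'])
    (hne : bivec e x' y' z' ≠ 0) (hr : ReducedEquiv e (bivec e x y z) (bivec e x' y' z')) :
    ∃ Q, IsAutomorphismMatrix M Q ∧ ![z', -y', x'] = Q.det • ![z, -y, x] := by
  have ht0 : axialVector M ≠ 0 := by
    rw [ht]
    rw [bivec_eq_hodge, ne_eq, LinearEquiv.map_eq_zero_iff] at hne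
    exact smul_ne_zero hs hne
  obtain ⟨Q, hQ, hv⟩ := hr.exists_isAutomorphismMatrix_vecMul h ht0
  subst h
  have hinv := hQ.axialVector_vecMul
  rw [ht, Matrix.smul_vecMul, smul_right_inj hs] at hinv
  exact ⟨Q, hQ, hinv.symm.trans hv⟩

theorem IsAutomorphismMatrix.det_mul_dotProduct_mulVec (hQ : IsAutomorphismMatrix M Q)
    (v : Fin 3 → ℝ) : (v ᵥ* Q) ⬝ᵥ M *ᵥ (v ᵥ* Q) = Q.det * (v ⬝ᵥ M *ᵥ v) := by
  rw [← smul_eq_mul, ← dotProduct_smul, ← Matrix.smul_mulVec, ← hQ.mul_mul_transpose,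
    ← Matrix.mulVec_mulVec, ← Matrix.mulVec_mulVec, Matrix.mulVec_transpose,
    Matrix.dotProduct_mulVec v]

theorem IsAutomorphismMatrix.det_pos (hQ : IsAutomorphismMatrix M Q)
    (hM : ∀ v, v ⬝ᵥ M *ᵥ v ≤ 0) {v : Fin 3 → ℝ} (hv : v ⬝ᵥ M *ᵥ v < 0) : 0 < Q.det := by
  refine lt_of_le_of_ne ?_ hQ.det_ne_zero.symm
  refine nonneg_of_mul_nonpos_left ?_ hv
  rw [← hQ.det_mul_dotProduct_mulVec]
  exact hM _

theorem IsAutomorphismMatrix.det_eq_one (hQ : IsAutomorphismMatrix M Q) (hM : M.det ≠ 0) :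
    Q.det = 1 := by
  have hdet := congrArg Matrix.det hQ.mul_mul_transpose
  rw [Matrix.det_mul, Matrix.det_mul, Matrix.det_transpose, Matrix.det_smul, Fintype.card_fin]
    at hdet
  refine mul_right_cancel₀ (mul_ne_zero (pow_ne_zero 2 hQ.det_ne_zero) hM) ?_
  linear_combination -hdet

theorem ReducedEquiv.exists_det_mul_dotProduct_eq (h : structureMatrix e = M)
    (ht : axialVector M = 0) (hr : ReducedEquiv e (hodge e b) (hodge e c)) :
    ∃ Q, IsAutomorphismMatrix M Q ∧ Q.det * (b ⬝ᵥ M *ᵥ b) = c ⬝ᵥ M *ᵥ c := by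
  subst h
  obtain ⟨Q, c', hQ, hv, hc⟩ := reducedEquiv_hodge_iff.1 hr
  rw [hodge_mem_inv2_iff_of_unimodular ht, Matrix.mulVec_sub, sub_eq_zero] at hc
  have hsymm : (structureMatrix e)ᵀ = structureMatrix e := axialVector_eq_zero_iff.1 ht
  refine ⟨Q, hQ, mul_left_cancel₀ hQ.det_ne_zero ?_⟩
  calc Q.det * (Q.det * (b ⬝ᵥ structureMatrix e *ᵥ b))
      = (c' ᵥ* Q) ⬝ᵥ structureMatrix e *ᵥ (c' ᵥ* Q) := by
        rw [hv, Matrix.mulVec_smul, smul_dotProduct, dotProduct_smul, smul_eq_mul, smul_eq_mul]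
    _ = Q.det * (c' ⬝ᵥ structureMatrix e *ᵥ c') := hQ.det_mul_dotProduct_mulVec c'
    _ = Q.det * (c ⬝ᵥ structureMatrix e *ᵥ c) := by
        rw [hc, Matrix.dotProduct_mulVec, ← Matrix.mulVec_transpose, hsymm, hc, dotProduct_comm]

end Equivalence

section Classifications

variable {L : Type*} [LieRing L] [LieAlgebra ℝ L] {e : Basis (Fin 3) ℝ L}

theorem eq_of_reducedEquiv_fin_two {r s : ⋀[ℝ]^2 L} (hrs : ¬ReducedEquiv e r s) (i j : Fin 2)
    (hij : ReducedEquiv e (![r, s] i) (![r, s] j)) : i = j := by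
  fin_cases i <;> fin_cases j
  exacts [rfl, (hrs hij).elim, (hrs hij.symm).elim, rfl]

theorem isClassification_heis (h : structureMatrix e = Row.heis.matrix) :
    IsClassification e (fun (_ : Unit) x _ _ => x ≠ 0) (fun _ => bivec e 1 0 0) where
  exists_iff x y z := by
    simp [Row.mcybe_iff h, Row.inv2_eq h, Row.YB, Row.inv2, bivec_mem_span_e13_e23_iff]
  rep_mem _ := by simp [bivec_mem_locus_iff]
  reducedEquiv_rep _ x y z hx := by
    refine reducedEquiv_bivec_of_matrix (d := 1 / x ^ 2)
      (Q := !![1 / x, 0, 0; 0, 1, 0; z / x ^ 2, -y / x ^ 2, 1 / x]) h ?_ (by positivity) ?_ ?_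
    · simp [Matrix.det_fin_three, sq]
    · ext i j
      fin_cases i <;> fin_cases j <;> simp [Row.matrix, Matrix.mul_apply, Fin.sum_univ_three, sq]
    · ext i
      fin_cases i <;> simp [Matrix.vecMul, dotProduct, Fin.sum_univ_three] <;> field_simp
  eq_of_reducedEquiv _ _ _ := rfl

theorem isClassification_r30' (h : structureMatrix e = Row.r30'.matrix) :
    IsClassification e (fun (_ : Unit) x y _ => 0 < x ^ 2 + y ^ 2) (fun _ => bivec e 1 0 0) where
  exists_iff x y z := by
    have hpos : 0 < x ^ 2 + y ^ 2 ↔ ¬(x = 0 ∧ y = 0) := by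
      rw [(add_nonneg (sq_nonneg x) (sq_nonneg y)).lt_iff_ne', ne_eq, sq, sq,
        mul_self_add_mul_self_eq_zero]
    simp [Row.mcybe_iff h, Row.inv2_eq h, Row.YB, Row.inv2, bivec_mem_span_e23_iff, hpos]
  rep_mem _ := by simp [bivec_mem_locus_iff]
  reducedEquiv_rep _ x y z hxy := by
    obtain ⟨n, hn⟩ : ∃ n, n = x ^ 2 + y ^ 2 := ⟨_, rfl⟩
    have hn0 : n ≠ 0 := hn ▸ hxy.ne'
    refine reducedEquiv_bivec_of_matrix (d := 1 / n)
      (Q := !![1, 0, 0; 0, x / n, y / n; z / n, -y / n, x / n]) h ?_ (by positivity) ?_ ?_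
    · simp only [Matrix.det_fin_three, Matrix.of_apply, Matrix.cons_val]
      field_simp
      rw [hn]
      ring
    · ext i j
      fin_cases i <;> fin_cases j <;>
        simp [Row.matrix, Matrix.mul_apply, Fin.sum_univ_three] <;> field_simp <;>
        first | ring1 | linear_combination hn
    · ext i
      fin_cases i <;> simp [Matrix.vecMul, dotProduct, Fin.sum_univ_three] <;> field_simp
  eq_of_reducedEquiv _ _ _ := rfl

theorem reducedEquiv_bivec_r3m1_of_mul_eq_zero (h : structureMatrix e = Row.r3m1.matrix)
    {x y : ℝ} (hmul : x * y = 0) (hsq : x ^ 2 + y ^ 2 ≠ 0) (z : ℝ) :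
    ReducedEquiv e (bivec e x y z) (bivec e 1 0 0) := by
  rcases mul_eq_zero.1 hmul with rfl | rfl
  · have hy : y ≠ 0 := by rintro rfl; simp at hsq
    refine reducedEquiv_bivec_of_matrix (d := -1 / y)
      (Q := !![-1, 0, 0; 0, 0, -1 / y; -z / y, 1, 0]) h ?_ (by simp [hy]) ?_ ?_
    · simp [Matrix.det_fin_three, neg_div]
    · ext i j
      fin_cases i <;> fin_cases j <;> simp [Row.matrix, Matrix.mul_apply, Fin.sum_univ_three]
    · ext i
      fin_cases i <;> simp [Matrix.vecMul, dotProduct, Fin.sum_univ_three] <;> field_simp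
  · have hx : x ≠ 0 := by rintro rfl; simp at hsq
    refine reducedEquiv_bivec_of_matrix (d := 1 / x)
      (Q := !![1, 0, 0; 0, 1 / x, 0; z / x, 0, 1]) h ?_ (by simp [hx]) ?_ ?_
    · simp [Matrix.det_fin_three]
    · ext i j
      fin_cases i <;> fin_cases j <;> simp [Row.matrix, Matrix.mul_apply, Fin.sum_univ_three]
    · ext i
      fin_cases i <;> simp [Matrix.vecMul, dotProduct, Fin.sum_univ_three] <;> field_simp

theorem reducedEquiv_bivec_r3m1_of_mul_ne_zero (h : structureMatrix e = Row.r3m1.matrix)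
    {x y : ℝ} (hmul : x * y ≠ 0) (z : ℝ) :
    ReducedEquiv e (bivec e x y z) (bivec e 1 (-1) 0) := by
  obtain ⟨hx, hy⟩ : x ≠ 0 ∧ y ≠ 0 := mul_ne_zero_iff.1 hmul
  refine reducedEquiv_bivec_of_matrix (d := -1 / (x * y))
    (Q := !![1, 0, 0; -z / (x * y), 1 / x, 0; 0, 0, -1 / y]) h ?_ (by simp [hx, hy]) ?_ ?_
  · simp [Matrix.det_fin_three]
    field_simp
  · ext i j
    fin_cases i <;> fin_cases j <;>
      simp [Row.matrix, Matrix.mul_apply, Fin.sum_univ_three] <;> field_simp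
  · ext i
    fin_cases i <;> simp [Matrix.vecMul, dotProduct, Fin.sum_univ_three] <;> field_simp

theorem isClassification_r3m1 (h : structureMatrix e = Row.r3m1.matrix) :
    IsClassification e
      ![fun x y _ => x * y = 0 ∧ x ^ 2 + y ^ 2 ≠ 0, fun x y _ => x * y ≠ 0]
      ![bivec e 1 0 0, bivec e 1 (-1) 0] where
  exists_iff x y z := by
    simp only [Row.mcybe_iff h, Row.inv2_eq h, Row.YB, Row.inv2, bivec_mem_span_e23_iff,
      Fin.exists_fin_two, Matrix.cons_val, sq, mul_self_add_mul_self_eq_zero, mul_eq_zero, ne_eq]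
    tauto
  rep_mem i := by
    fin_cases i <;> simp [bivec_mem_locus_iff]
  reducedEquiv_rep i x y z hxy := by
    fin_cases i
    · exact reducedEquiv_bivec_r3m1_of_mul_eq_zero h hxy.1 hxy.2 z
    · exact reducedEquiv_bivec_r3m1_of_mul_ne_zero h hxy z
  eq_of_reducedEquiv := by
    refine eq_of_reducedEquiv_fin_two fun hr => ?_
    rw [bivec_eq_hodge, bivec_eq_hodge] at hr
    obtain ⟨Q, -, hd⟩ := hr.exists_det_mul_dotProduct_eq h <|
      Row.r3m1.axialVector_matrix_eq_zero_iff.2 trivial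
    simp [Row.matrix, Matrix.mulVec, dotProduct, Fin.sum_univ_three, one_add_one_eq_two] at hd

variable {M : Matrix (Fin 3) (Fin 3) ℝ}

theorem eq_of_reducedEquiv_fin_three {r s t : ⋀[ℝ]^2 L} (hrs : ¬ReducedEquiv e r s)
    (hrt : ¬ReducedEquiv e r t) (hst : ¬ReducedEquiv e s t) (i j : Fin 3)
    (hij : ReducedEquiv e (![r, s, t] i) (![r, s, t] j)) : i = j := by
  fin_cases i <;> fin_cases j
  exacts [rfl, (hrs hij).elim, (hrt hij).elim, (hrs hij.symm).elim, rfl, (hst hij).elim,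
    (hrt hij.symm).elim, (hst hij.symm).elim, rfl]

theorem isClassification_r31 (h : structureMatrix e = Row.r31.matrix) :
    IsClassification e
      ![fun x y _ => x ^ 2 + y ^ 2 ≠ 0, fun x y z => x = 0 ∧ y = 0 ∧ z ≠ 0]
      ![bivec e 0 1 0, bivec e 0 0 1] where
  exists_iff x y z := by
    simp only [Row.mcybe_iff h, Row.inv2_eq h, Row.YB, Row.inv2, Submodule.mem_bot,
      bivec_eq_zero_iff, Fin.exists_fin_two, Matrix.cons_val, sq,
      mul_self_add_mul_self_eq_zero, ne_eq]
    tauto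
  rep_mem i := by
    fin_cases i <;> simp [bivec_mem_locus_iff]
  reducedEquiv_rep i x y z hxy := by
    fin_cases i
    · obtain ⟨n, hn⟩ : ∃ n, n = x ^ 2 + y ^ 2 := ⟨_, rfl⟩
      have hn0 : n ≠ 0 := hn ▸ hxy
      refine reducedEquiv_bivec_of_matrix (d := 1)
        (Q := !![1, 0, 0; -z, y, -x; 0, x / n, y / n]) h ?_ one_ne_zero ?_ ?_
      · simp only [Matrix.det_fin_three, Matrix.of_apply, Matrix.cons_val]
        field_simp
        linear_combination -hn
      · ext i j
        fin_cases i <;> fin_cases j <;>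
          simp [Row.matrix, Matrix.mul_apply, Fin.sum_univ_three] <;> field_simp <;>
          first | ring1 | linear_combination hn | linear_combination -hn
      · ext i
        fin_cases i <;> simp [Matrix.vecMul, dotProduct, Fin.sum_univ_three]
    · obtain ⟨rfl, rfl, hz⟩ : x = 0 ∧ y = 0 ∧ z ≠ 0 := hxy
      refine reducedEquiv_bivec_of_matrix (d := 1 / z)
        (Q := .diagonal ![1, 1 / z, 1]) h ?_ (by simp [hz]) ?_ ?_
      · simp [Fin.prod_univ_three]
      · ext i j
        fin_cases i <;> fin_cases j <;> simp [Row.matrix]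
      · ext i
        fin_cases i <;> simp [Matrix.vecMul_diagonal, hz]
  eq_of_reducedEquiv := by
    refine eq_of_reducedEquiv_fin_two fun hr => ?_
    obtain ⟨Q, -, hQ⟩ := hr.exists_eq_det_smul_of_axialVector_eq_smul h two_ne_zero
      (by simp [axialVector, Row.matrix, one_add_one_eq_two]) (by simp [bivec_eq_zero_iff])
    simpa using congrFun hQ 0

theorem reducedEquiv_bivec_of_pos (h : structureMatrix e = M) (hrow : M 2 = 0)
    (hcol : M.col 2 = 0) {x : ℝ} (hx : 0 < x) : ReducedEquiv e (bivec e x 0 0) (bivec e 1 0 0) := by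
  have hsq : (√x)⁻¹ ^ 2 * x = 1 := by rw [inv_pow, Real.sq_sqrt hx.le, inv_mul_cancel₀ hx.ne']
  have ha : (√x)⁻¹ ≠ 0 := inv_ne_zero (Real.sqrt_ne_zero'.2 hx)
  simpa only [hsq] using reducedEquiv_bivec_sq_mul h hrow hcol ha x

theorem reducedEquiv_bivec_of_neg (h : structureMatrix e = M) (hrow : M 2 = 0)
    (hcol : M.col 2 = 0) {x : ℝ} (hx : x < 0) :
    ReducedEquiv e (bivec e x 0 0) (bivec e (-1) 0 0) := by
  have hsq : (√(-x))⁻¹ ^ 2 * x = -1 := by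
    rw [inv_pow, Real.sq_sqrt (neg_pos.2 hx).le, inv_neg, neg_mul, inv_mul_cancel₀ hx.ne]
  have ha : (√(-x))⁻¹ ≠ 0 := inv_ne_zero (Real.sqrt_ne_zero'.2 (neg_pos.2 hx))
  simpa only [hsq] using reducedEquiv_bivec_sq_mul h hrow hcol ha x

theorem not_reducedEquiv_bivec_neg_one (h : structureMatrix e = M) {s : ℝ} (hs : s ≠ 0)
    (ht : axialVector M = s • ![0, 0, 1]) (hM : ∀ v, v ⬝ᵥ M *ᵥ v ≤ 0) {v : Fin 3 → ℝ}
    (hv : v ⬝ᵥ M *ᵥ v < 0) : ¬ReducedEquiv e (bivec e 1 0 0) (bivec e (-1) 0 0) := by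
  intro hr
  obtain ⟨Q, hQ, hd⟩ := hr.exists_eq_det_smul_of_axialVector_eq_smul h (neg_ne_zero.2 hs)
    (by simpa using ht) (by simp [bivec_eq_zero_iff])
  have hdet : -1 = Q.det := by simpa using congrFun hd 2
  exact absurd (hQ.det_pos hM hv) (by norm_num [← hdet])

theorem reducedEquiv_bivec_r3_of_ne_zero (h : structureMatrix e = Row.r3.matrix) (x : ℝ) {y : ℝ}
    (hy : y ≠ 0) : ReducedEquiv e (bivec e x y 0) (bivec e 0 1 0) := by
  refine reducedEquiv_bivec_of_matrix (d := 1 / y ^ 2)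
    (Q := !![1 / y, 0, 0; 0, 1 / y, -x / y ^ 2; 0, 0, 1]) h ?_ (by simp [hy]) ?_ ?_
  · simp [Matrix.det_fin_three, sq]
  · ext i j
    fin_cases i <;> fin_cases j <;>
      simp [Row.matrix, Matrix.mul_apply, Fin.sum_univ_three] <;> field_simp
  · ext i
    fin_cases i <;> simp [Matrix.vecMul, dotProduct, Fin.sum_univ_three] <;> field_simp

theorem isClassification_r3 (h : structureMatrix e = Row.r3.matrix) :
    IsClassification e
      ![fun x y z => 0 < x ∧ y = 0 ∧ z = 0, fun x y z => x < 0 ∧ y = 0 ∧ z = 0,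
        fun _ y z => y ≠ 0 ∧ z = 0]
      ![bivec e 1 0 0, bivec e (-1) 0 0, bivec e 0 1 0] where
  exists_iff x y z := by
    simp only [Row.mcybe_iff h, Row.inv2_eq h, Row.YB, Row.inv2, Submodule.mem_bot,
      bivec_eq_zero_iff, Fin.exists_fin_succ, Fin.exists_fin_zero, Matrix.cons_val_zero,
      Matrix.cons_val_succ, or_false]
    have := lt_or_lt_iff_ne (a := x) (b := 0)
    tauto
  rep_mem i := by
    fin_cases i <;> simp [bivec_mem_locus_iff]
  reducedEquiv_rep i x y z hxy := by
    have hrow : Row.r3.matrix 2 = 0 := by ext j; fin_cases j <;> rfl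
    have hcol : Row.r3.matrix.col 2 = 0 := by ext j; fin_cases j <;> rfl
    fin_cases i
    · obtain ⟨hx, rfl, rfl⟩ : 0 < x ∧ y = 0 ∧ z = 0 := hxy
      exact reducedEquiv_bivec_of_pos h hrow hcol hx
    · obtain ⟨hx, rfl, rfl⟩ : x < 0 ∧ y = 0 ∧ z = 0 := hxy
      exact reducedEquiv_bivec_of_neg h hrow hcol hx
    · obtain ⟨hy, rfl⟩ : y ≠ 0 ∧ z = 0 := hxy
      exact reducedEquiv_bivec_r3_of_ne_zero h x hy
  eq_of_reducedEquiv := by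
    have hs : (2 : ℝ) ≠ 0 := two_ne_zero
    have ht : axialVector Row.r3.matrix = (2 : ℝ) • ![0, 0, 1] := by
      simp [axialVector, Row.matrix, one_add_one_eq_two]
    have hform (v : Fin 3 → ℝ) : v ⬝ᵥ Row.r3.matrix *ᵥ v = -v 0 ^ 2 := by
      simp only [Row.matrix, Matrix.mulVec, dotProduct, Fin.sum_univ_three, Matrix.of_apply,
        Matrix.cons_val]
      ring
    refine eq_of_reducedEquiv_fin_three ?_ (fun hr => ?_) (fun hr => ?_)
    · exact not_reducedEquiv_bivec_neg_one h hs ht (fun v => by simp [hform, sq_nonneg])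
        (v := ![1, 0, 0]) (by simp [hform])
    · obtain ⟨Q, -, hQ⟩ := hr.symm.exists_eq_det_smul_of_axialVector_eq_smul h hs
        (by simpa using ht) (by simp [bivec_eq_zero_iff])
      simpa using congrFun hQ 2
    · obtain ⟨Q, -, hQ⟩ := hr.symm.exists_eq_det_smul_of_axialVector_eq_smul h (neg_ne_zero.2 hs)
        (by simpa using ht) (by simp [bivec_eq_zero_iff])
      simpa using congrFun hQ 2

theorem isClassification_r3l' {l : ℝ} (hl : l ≠ 0)
    (h : structureMatrix e = (Row.r3l' l hl).matrix) :
    IsClassification e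
      ![fun x y z => 0 < x ∧ y = 0 ∧ z = 0, fun x y z => x < 0 ∧ y = 0 ∧ z = 0]
      ![bivec e 1 0 0, bivec e (-1) 0 0] where
  exists_iff x y z := by
    simp only [Row.mcybe_iff h, Row.inv2_eq h, Row.YB, Row.inv2, Submodule.mem_bot,
      bivec_eq_zero_iff, Fin.exists_fin_two, Matrix.cons_val]
    have := lt_or_lt_iff_ne (a := x) (b := 0)
    tauto
  rep_mem i := by
    fin_cases i <;> simp [bivec_mem_locus_iff]
  reducedEquiv_rep i x y z hxy := by
    have hrow : (Row.r3l' l hl).matrix 2 = 0 := by ext j; fin_cases j <;> rfl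
    have hcol : (Row.r3l' l hl).matrix.col 2 = 0 := by ext j; fin_cases j <;> rfl
    fin_cases i
    · obtain ⟨hx, rfl, rfl⟩ : 0 < x ∧ y = 0 ∧ z = 0 := hxy
      exact reducedEquiv_bivec_of_pos h hrow hcol hx
    · obtain ⟨hx, rfl, rfl⟩ : x < 0 ∧ y = 0 ∧ z = 0 := hxy
      exact reducedEquiv_bivec_of_neg h hrow hcol hx
  eq_of_reducedEquiv := by
    have ht : axialVector (Row.r3l' l hl).matrix = (l + l) • ![0, 0, 1] := by
      simp [axialVector, Row.matrix]
    have hform (v : Fin 3 → ℝ) :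
        v ⬝ᵥ (Row.r3l' l hl).matrix *ᵥ v = -(v 0 ^ 2 + v 1 ^ 2) := by
      simp only [Row.matrix, Matrix.mulVec, dotProduct, Fin.sum_univ_three, Matrix.of_apply,
        Matrix.cons_val]
      ring
    refine eq_of_reducedEquiv_fin_two <|
      not_reducedEquiv_bivec_neg_one h (by simpa using hl) ht (fun v => ?_) (v := ![1, 0, 0]) ?_
    · rw [hform, neg_nonpos]
      positivity
    · simp [hform]

theorem not_reducedEquiv_r3l {l : ℝ} (hl : -1 < l ∧ l < 1)
    (h : structureMatrix e = (Row.r3l l hl).matrix) :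
    ¬ReducedEquiv e (bivec e 0 0 1) (bivec e 0 1 0) := by
  intro hr
  obtain ⟨Q, hQ, hv⟩ := hr.exists_isAutomorphismMatrix_vecMul h <|
    (Row.r3l l hl).axialVector_matrix_eq_zero_iff.not.2 id
  have hrow₁ (j : Fin 3) : -Q 1 j = Q.det * ![1, 0, 0] j := by
    simpa [Matrix.vecMul, dotProduct, Fin.sum_univ_three] using congrFun hv j
  have hQ₁₁ : Q 1 1 = 0 := by simpa using hrow₁ 1
  have hQ₁₂ : Q 1 2 = 0 := by simpa using hrow₁ 2
  have haxial := IsAutomorphismMatrix.axialVector_vecMul (h ▸ hQ)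
  have hrow₂ (j : Fin 3) : (1 + l) * Q 2 j = ![0, 0, 1 + l] j := by
    simpa [h, Row.matrix, axialVector, Matrix.vecMul, dotProduct, Fin.sum_univ_three] using
      congrFun haxial j
  have hl₁ : 1 + l ≠ 0 := by linarith [hl.1]
  have hQ₂₁ : Q 2 1 = 0 := by simpa [hl₁] using hrow₂ 1
  have hQ₂₂ : Q 2 2 = 1 := by simpa [hl₁] using hrow₂ 2
  have hdet : Q.det = -(Q 0 1 * Q 1 0) := by
    simp [Matrix.det_fin_three, hQ₁₁, hQ₁₂, hQ₂₁, hQ₂₂]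
  have hentry : -(Q 0 1 * l * Q 1 0) = Q.det := by
    simpa [Row.matrix, Matrix.mul_apply, Fin.sum_univ_three, hQ₁₁] using
      congrFun (congrFun hQ.mul_mul_transpose 0) 1
  have hl' : (1 - l) * Q.det = 0 := by linear_combination -hentry - l * hdet
  exact mul_ne_zero (by linarith [hl.2]) hQ.det_ne_zero hl'

theorem reducedEquiv_bivec_r3l_e23 {l : ℝ} {hl : -1 < l ∧ l < 1}
    (h : structureMatrix e = (Row.r3l l hl).matrix) (x : ℝ) {z : ℝ} (hz : z ≠ 0) :
    ReducedEquiv e (bivec e x 0 z) (bivec e 0 0 1) := by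
  refine reducedEquiv_bivec_of_matrix (d := 1 / z)
    (Q := !![1, 0, x / z; 0, 1 / z, 0; 0, 0, 1]) h ?_ (by simp [hz]) ?_ ?_
  · simp [Matrix.det_fin_three]
  · ext i j
    fin_cases i <;> fin_cases j <;>
      simp [Row.matrix, Matrix.mul_apply, Fin.sum_univ_three, mul_comm]
  · ext i
    fin_cases i <;> simp [Matrix.vecMul, dotProduct, Fin.sum_univ_three, hz, div_eq_inv_mul]

theorem reducedEquiv_bivec_r3l_e13 {l : ℝ} {hl : -1 < l ∧ l < 1}
    (h : structureMatrix e = (Row.r3l l hl).matrix) (x : ℝ) {y : ℝ} (hy : y ≠ 0) :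
    ReducedEquiv e (bivec e x y 0) (bivec e 0 1 0) := by
  refine reducedEquiv_bivec_of_matrix (d := 1 / y)
    (Q := !![1 / y, 0, 0; 0, 1, -x / y; 0, 0, 1]) h ?_ (by simp [hy]) ?_ ?_
  · simp [Matrix.det_fin_three]
  · ext i j
    fin_cases i <;> fin_cases j <;>
      simp [Row.matrix, Matrix.mul_apply, Fin.sum_univ_three, mul_comm]
  · ext i
    fin_cases i <;> simp [Matrix.vecMul, dotProduct, Fin.sum_univ_three, hy, div_eq_inv_mul]

theorem reducedEquiv_bivec_r3l_e12 {l : ℝ} {hl : -1 < l ∧ l < 1}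
    (h : structureMatrix e = (Row.r3l l hl).matrix) {x : ℝ} (hx : x ≠ 0) :
    ReducedEquiv e (bivec e x 0 0) (bivec e 1 0 0) := by
  refine reducedEquiv_bivec_of_matrix (d := 1 / x)
    (Q := .diagonal ![1 / x, 1, 1]) h ?_ (by simp [hx]) ?_ ?_
  · simp [Fin.prod_univ_three]
  · ext i j
    fin_cases i <;> fin_cases j <;> simp [Row.matrix, mul_comm]
  · ext i
    fin_cases i <;> simp [Matrix.vecMul_diagonal, hx]

theorem isClassification_r3l {l : ℝ} (hl : -1 < l ∧ l < 1)
    (h : structureMatrix e = (Row.r3l l hl).matrix) :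
    IsClassification e
      ![fun _ y z => y = 0 ∧ z ≠ 0, fun _ y z => z = 0 ∧ y ≠ 0,
        fun x y z => y = 0 ∧ z = 0 ∧ x ≠ 0]
      ![bivec e 0 0 1, bivec e 0 1 0, bivec e 1 0 0] where
  exists_iff x y z := by
    simp only [Row.mcybe_iff h, Row.inv2_eq h, Row.YB, Row.inv2, Submodule.mem_bot,
      bivec_eq_zero_iff, Fin.exists_fin_succ, Fin.exists_fin_zero, Matrix.cons_val_zero,
      Matrix.cons_val_succ, or_false]
    tauto
  rep_mem i := by
    fin_cases i <;> simp [bivec_mem_locus_iff]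
  reducedEquiv_rep i x y z hxy := by
    fin_cases i
    · obtain ⟨rfl, hz⟩ : y = 0 ∧ z ≠ 0 := hxy
      exact reducedEquiv_bivec_r3l_e23 h x hz
    · obtain ⟨rfl, hy⟩ : z = 0 ∧ y ≠ 0 := hxy
      exact reducedEquiv_bivec_r3l_e13 h x hy
    · obtain ⟨rfl, rfl, hx⟩ : y = 0 ∧ z = 0 ∧ x ≠ 0 := hxy
      exact reducedEquiv_bivec_r3l_e12 h hx
  eq_of_reducedEquiv := by
    have hs : 1 + l ≠ 0 := by linarith [hl.1]
    have ht : axialVector (Row.r3l l hl).matrix = (1 + l) • ![0, 0, 1] := by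
      simp [axialVector, Row.matrix]
    refine eq_of_reducedEquiv_fin_three (not_reducedEquiv_r3l hl h) (fun hr => ?_) (fun hr => ?_)
    · obtain ⟨Q, -, hQ⟩ := hr.exists_eq_det_smul_of_axialVector_eq_smul h hs
        (by simpa using ht) (by simp [bivec_eq_zero_iff])
      simpa using congrFun hQ 2
    · obtain ⟨Q, -, hQ⟩ := hr.exists_eq_det_smul_of_axialVector_eq_smul h hs
        (by simpa using ht) (by simp [bivec_eq_zero_iff])
      simpa using congrFun hQ 2

variable {x y z x' y' z' : ℝ}

theorem exists_mul_transpose_eq_one_row_eq {p q r : ℝ} (hu : p ^ 2 + q ^ 2 + r ^ 2 = 1) :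
    ∃ Q : Matrix (Fin 3) (Fin 3) ℝ, Q.det = 1 ∧ Q * Qᵀ = 1 ∧ Q 2 = ![p, q, r] := by
  by_cases hr : 1 + r = 0
  · obtain rfl : r = -1 := by linarith
    obtain ⟨rfl, rfl⟩ : p = 0 ∧ q = 0 := by
      rw [← mul_self_add_mul_self_eq_zero]
      linarith
    refine ⟨.diagonal ![1, -1, -1], ?_, ?_, ?_⟩
    · simp [Fin.prod_univ_three]
    · ext i j
      fin_cases i <;> fin_cases j <;> simp
    · ext j
      fin_cases j <;> simp
  · -- the half-turn about the bisector of the third basis vector and `(p, q, r)`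
    refine ⟨!![p ^ 2 / (1 + r) - 1, p * q / (1 + r), p;
      p * q / (1 + r), q ^ 2 / (1 + r) - 1, q; p, q, r], ?_, ?_, rfl⟩
    · simp only [Matrix.det_fin_three, Matrix.of_apply, Matrix.cons_val]
      field_simp
      grind
    · ext i j
      fin_cases i <;> fin_cases j <;> simp [Matrix.mul_apply, Fin.sum_univ_three] <;>
        field_simp <;> grind

theorem isClassification_su2 (h : structureMatrix e = Row.su2.matrix) :
    IsClassification e (fun (k : {k : ℝ // 0 < k}) x y z => x ^ 2 + y ^ 2 + z ^ 2 = k)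
      (fun k => bivec e √k 0 0) where
  exists_iff x y z := by
    have hnonneg : 0 ≤ x ^ 2 + y ^ 2 + z ^ 2 := by positivity
    have hpos : 0 < x ^ 2 + y ^ 2 + z ^ 2 ↔ ¬(x = 0 ∧ y = 0 ∧ z = 0) := by
      rw [hnonneg.lt_iff_ne', ne_eq,
        add_eq_zero_iff_of_nonneg (add_nonneg (sq_nonneg x) (sq_nonneg y)) (sq_nonneg z),
        add_eq_zero_iff_of_nonneg (sq_nonneg x) (sq_nonneg y)]
      simp only [sq_eq_zero_iff, and_assoc]
    simp only [Row.mcybe_iff h, Row.inv2_eq h, Row.YB, Row.inv2, Submodule.mem_bot, true_and,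
      bivec_eq_zero_iff, ← hpos]
    exact ⟨fun ⟨k, hk⟩ => hk ▸ k.2, fun hk => ⟨⟨_, hk⟩, rfl⟩⟩
  rep_mem k := by simp [bivec_mem_locus_iff, k.2.le]
  reducedEquiv_rep k x y z hk := by
    have hk₀ : √k.1 ≠ 0 := Real.sqrt_ne_zero'.2 k.2
    have hu : (z / √k) ^ 2 + (-y / √k) ^ 2 + (x / √k) ^ 2 = 1 := by
      rw [div_pow, div_pow, div_pow, Real.sq_sqrt k.2.le, ← add_div, ← add_div,
        div_eq_one_iff_eq k.2.ne', ← hk]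
      ring
    obtain ⟨Q, hdet, hQ, hrow⟩ := exists_mul_transpose_eq_one_row_eq hu
    refine reducedEquiv_bivec_of_matrix h hdet one_ne_zero ?_ ?_
    · have hM : Row.su2.matrix = 1 := by ext i j; fin_cases i <;> fin_cases j <;> rfl
      rw [hM, mul_one, hQ, one_smul]
    · ext j
      have hrow_j := congrFun hrow j
      fin_cases j <;> simp_all [Matrix.vecMul, dotProduct, Fin.sum_univ_three, mul_div_cancel₀]
  eq_of_reducedEquiv k k' hr := by
    rw [bivec_eq_hodge, bivec_eq_hodge] at hr
    obtain ⟨Q, hQ, hd⟩ := hr.exists_det_mul_dotProduct_eq h <|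
      Row.su2.axialVector_matrix_eq_zero_iff.2 trivial
    rw [hQ.det_eq_one (by simp [Row.matrix, Matrix.det_fin_three])] at hd
    simpa [Row.matrix, Matrix.mulVec, dotProduct, Fin.sum_univ_three, Real.mul_self_sqrt,
      k.2.le, k'.2.le, Subtype.ext_iff] using hd

theorem reducedEquiv_bivec_sl2_of_ne_zero (h : structureMatrix e = Row.sl2.matrix) (hx : x ≠ 0)
    (y z : ℝ) : ReducedEquiv e (bivec e x y z) (bivec e 1 ((2 * x * y - z ^ 2) / 2) 0) := by
  refine reducedEquiv_bivec_of_matrix (d := 1)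
    (Q := !![1, -z / x, 0; 0, 1 / x, 0; z, -z ^ 2 / (2 * x), x]) h ?_ one_ne_zero ?_ ?_
  · simp [Matrix.det_fin_three, hx]
  · ext i j
    fin_cases i <;> fin_cases j <;>
      simp [Row.matrix, Matrix.mul_apply, Fin.sum_univ_three] <;> field_simp <;> ring
  · ext i
    fin_cases i <;> simp [Matrix.vecMul, dotProduct, Fin.sum_univ_three]
    all_goals
      field_simp
      ring

theorem reducedEquiv_bivec_sl2_swap (h : structureMatrix e = Row.sl2.matrix) (x y z : ℝ) :
    ReducedEquiv e (bivec e x y z) (bivec e (-y) (-x) (-z)) := by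
  refine reducedEquiv_bivec_of_matrix (d := 1)
    (Q := !![-1, 0, 0; 0, 0, 1; 0, 1, 0]) h ?_ one_ne_zero ?_ ?_
  · simp [Matrix.det_fin_three]
  · ext i j
    fin_cases i <;> fin_cases j <;> simp [Row.matrix, Matrix.mul_apply, Fin.sum_univ_three]
  · ext i
    fin_cases i <;> simp [Matrix.vecMul, dotProduct, Fin.sum_univ_three]

theorem reducedEquiv_bivec_sl2_shear (h : structureMatrix e = Row.sl2.matrix) (z : ℝ) :
    ReducedEquiv e (bivec e 0 0 z) (bivec e 0 z z) := by
  refine reducedEquiv_bivec_of_matrix (d := 1)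
    (Q := !![1, 1, 0; 0, 1, 0; -1, -1 / 2, 1]) h ?_ one_ne_zero ?_ ?_
  · simp [Matrix.det_fin_three]
  · ext i j
    fin_cases i <;> fin_cases j <;> simp [Row.matrix, Matrix.mul_apply, Fin.sum_univ_three]
    norm_num
  · ext i
    fin_cases i <;> simp [Matrix.vecMul, dotProduct, Fin.sum_univ_three]

theorem reducedEquiv_bivec_sl2 (h : structureMatrix e = Row.sl2.matrix)
    (hne : bivec e x y z ≠ 0) :
    ReducedEquiv e (bivec e x y z) (bivec e 1 ((2 * x * y - z ^ 2) / 2) 0) := by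
  have hof (x y z : ℝ) (hy : y ≠ 0) :
      ReducedEquiv e (bivec e x y z) (bivec e 1 ((2 * x * y - z ^ 2) / 2) 0) := by
    convert (reducedEquiv_bivec_sl2_swap h x y z).trans
      (reducedEquiv_bivec_sl2_of_ne_zero h (neg_ne_zero.2 hy) (-x) (-z)) using 3
    ring
  by_cases hx : x = 0
  · by_cases hy : y = 0
    · subst hx hy
      have hz : z ≠ 0 := by simpa [bivec_eq_zero_iff] using hne
      convert (reducedEquiv_bivec_sl2_shear h z).trans (hof 0 z z hz) using 3
      ring
    · exact hof x y z hy
  · exact reducedEquiv_bivec_sl2_of_ne_zero h hx y z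

theorem reducedEquiv_bivec_sl2_iff (h : structureMatrix e = Row.sl2.matrix)
    (hne : bivec e x y z ≠ 0) (hne' : bivec e x' y' z' ≠ 0) :
    ReducedEquiv e (bivec e x y z) (bivec e x' y' z') ↔
      2 * x * y - z ^ 2 = 2 * x' * y' - z' ^ 2 := by
  constructor
  · intro hr
    rw [bivec_eq_hodge, bivec_eq_hodge] at hr
    obtain ⟨Q, hQ, hd⟩ := hr.exists_det_mul_dotProduct_eq h <|
      Row.sl2.axialVector_matrix_eq_zero_iff.2 trivial
    rw [hQ.det_eq_one (by simp [Row.matrix, Matrix.det_fin_three])] at hd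
    simp only [Row.matrix, Matrix.mulVec, dotProduct, Fin.sum_univ_three, Matrix.of_apply,
      Matrix.cons_val] at hd
    linear_combination -hd
  · intro heq
    refine (reducedEquiv_bivec_sl2 h hne).trans ?_
    rw [heq]
    exact (reducedEquiv_bivec_sl2 h hne').symm

/-- The representative of the bivectors with `2xy - z² = k` in `sl₂`. -/
def sl2Rep (e : Basis (Fin 3) ℝ L) (k : ℝ) : ⋀[ℝ]^2 L :=
  if k < 0 then bivec e 0 0 √(-k) else if 0 < k then bivec e √(k / 2) √(k / 2) 0 else bivec e 1 0 0

theorem sl2Rep_mem_locus (e : Basis (Fin 3) ℝ L) (k : ℝ) :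
    sl2Rep e k ∈ locus e fun x y z => 2 * x * y - z ^ 2 = k ∧ (k = 0 → x ^ 2 + y ^ 2 ≠ 0) := by
  unfold sl2Rep
  split_ifs with hneg hpos
  · simp [bivec_mem_locus_iff, hneg.ne, hneg.le]
  · have hsq : 2 * √(k / 2) * √(k / 2) = k := by
      rw [mul_assoc, Real.mul_self_sqrt (by positivity), mul_div_cancel₀ k two_ne_zero]
    exact (bivec_mem_locus_iff ..).2 ⟨by rw [hsq]; ring, fun hk => (hpos.ne' hk).elim⟩
  · simp [bivec_mem_locus_iff, le_antisymm (not_lt.1 hpos) (not_lt.1 hneg)]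

theorem isClassification_sl2 (h : structureMatrix e = Row.sl2.matrix) :
    IsClassification e
      (fun k x y z => 2 * x * y - z ^ 2 = k ∧ (k = 0 → x ^ 2 + y ^ 2 ≠ 0)) (sl2Rep e) := by
  have hne {k x y z : ℝ} (hk : 2 * x * y - z ^ 2 = k ∧ (k = 0 → x ^ 2 + y ^ 2 ≠ 0)) :
      bivec e x y z ≠ 0 := by
    rw [ne_eq, bivec_eq_zero_iff]
    rintro ⟨rfl, rfl, rfl⟩
    exact hk.2 (by simpa using hk.1.symm) (by simp)
  refine ⟨fun x y z => ?_, sl2Rep_mem_locus e, fun k x y z hk => ?_, fun k k' hr => ?_⟩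
  · simp only [Row.mcybe_iff h, Row.inv2_eq h, Row.YB, Row.inv2, Submodule.mem_bot, true_and]
    refine ⟨fun ⟨k, hk⟩ => hne hk, fun hxyz => ⟨_, rfl, fun hk hxy => hxyz ?_⟩⟩
    obtain ⟨rfl, rfl⟩ : x = 0 ∧ y = 0 := by rwa [sq, sq, mul_self_add_mul_self_eq_zero] at hxy
    simpa [bivec_eq_zero_iff] using hk
  · obtain ⟨x', y', z', hk', hrep⟩ := sl2Rep_mem_locus e k
    rw [hrep, reducedEquiv_bivec_sl2_iff h (hne hk) (hne hk'), hk.1, hk'.1]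
  · obtain ⟨x, y, z, hk, hrep⟩ := sl2Rep_mem_locus e k
    obtain ⟨x', y', z', hk', hrep'⟩ := sl2Rep_mem_locus e k'
    rwa [hrep, hrep', reducedEquiv_bivec_sl2_iff h (hne hk) (hne hk'), hk.1, hk'.1] at hr

theorem sl2_classes_eq_range (e : Basis (Fin 3) ℝ L) : Row.sl2.classes e = Set.range fun k =>
    locus e fun x y z => 2 * x * y - z ^ 2 = k ∧ (k = 0 → x ^ 2 + y ^ 2 ≠ 0) := by
  ext C
  constructor
  · rintro (⟨k, hk, rfl⟩ | rfl)
    · exact ⟨k, by simp [hk]⟩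
    · exact ⟨0, by simp⟩
  · rintro ⟨k, rfl⟩
    by_cases hk : k = 0
    · exact Or.inr (by simp [hk])
    · exact Or.inl ⟨k, hk, by simp [hk]⟩

theorem sl2_reps_eq_range (e : Basis (Fin 3) ℝ L) : Row.sl2.reps e = Set.range (sl2Rep e) := by
  ext r
  constructor
  · rintro ((⟨a, ha, rfl⟩ | ⟨a, ha, rfl⟩) | rfl)
    · exact ⟨-a ^ 2, by simp [sl2Rep, bivec, ha.ne', ha.le]⟩
    · exact ⟨2 * a ^ 2, by simp [sl2Rep, bivec, ha, ha.le]⟩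
    · exact ⟨0, by simp [sl2Rep, bivec]⟩
  · rintro ⟨k, rfl⟩
    unfold sl2Rep
    split_ifs with hneg hpos
    · exact Or.inl (Or.inl ⟨√(-k), by simpa using hneg, by simp [bivec]⟩)
    · exact Or.inl (Or.inr ⟨√(k / 2), by positivity, by simp [bivec]⟩)
    · exact Or.inr (by simp [bivec])

theorem su2_classes_eq_range (e : Basis (Fin 3) ℝ L) : Row.su2.classes e =
    Set.range fun (k : {k : ℝ // 0 < k}) => locus e fun x y z => x ^ 2 + y ^ 2 + z ^ 2 = k := by
  ext C
  simp [Row.classes, eq_comm]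

theorem su2_reps_eq_range (e : Basis (Fin 3) ℝ L) :
    Row.su2.reps e = Set.range fun (k : {k : ℝ // 0 < k}) => bivec e √k 0 0 := by
  ext r
  constructor
  · rintro ⟨a, ha, rfl⟩
    exact ⟨⟨a ^ 2, by positivity⟩, by simp [bivec, ha.le]⟩
  · rintro ⟨k, rfl⟩
    exact ⟨√k, Real.sqrt_pos.2 k.2, by simp [bivec]⟩

theorem range_comp_fin_two {α β : Type*} (f : α → β) (a b : α) :
    Set.range (fun i => f (![a, b] i)) = {f a, f b} := by
  ext
  simp [Fin.exists_fin_two, eq_comm]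

theorem range_comp_fin_three {α β : Type*} (f : α → β) (a b c : α) :
    Set.range (fun i => f (![a, b, c] i)) = {f a, f b, f c} := by
  ext
  simp [Fin.exists_fin_succ, eq_comm]

theorem Row.exists_isClassification {t : Row} (h : structureMatrix e = t.matrix) :
    ∃ (ι : Type) (P : ι → ℝ → ℝ → ℝ → Prop) (ρ : ι → ⋀[ℝ]^2 L), IsClassification e P ρ ∧
      t.classes e = Set.range (fun i => locus e (P i)) ∧ t.reps e = Set.range ρ := by
  have he12 : e12 e = bivec e 1 0 0 := by simp [bivec]
  have he13 : e13 e = bivec e 0 1 0 := by simp [bivec]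
  have he23 : e23 e = bivec e 0 0 1 := by simp [bivec]
  have hneg : -bivec e 1 0 0 = bivec e (-1) 0 0 := by
    simp only [bivec]
    module
  have hsub : bivec e 1 0 0 - bivec e 0 1 0 = bivec e 1 (-1) 0 := by
    simp only [bivec]
    module
  cases t with
  | sl2 => exact ⟨_, _, _, isClassification_sl2 h, sl2_classes_eq_range e, sl2_reps_eq_range e⟩
  | su2 => exact ⟨_, _, _, isClassification_su2 h, su2_classes_eq_range e, su2_reps_eq_range e⟩
  | heis =>
    exact ⟨_, _, _, isClassification_heis h, Set.range_const.symm, he12 ▸ Set.range_const.symm⟩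
  | r30' =>
    exact ⟨_, _, _, isClassification_r30' h, Set.range_const.symm, he12 ▸ Set.range_const.symm⟩
  | r3m1 =>
    refine ⟨_, _, _, isClassification_r3m1 h, (range_comp_fin_two (locus e) _ _).symm, ?_⟩
    rw [Row.reps, he12, he13, hsub]
    exact (range_comp_fin_two id _ _).symm
  | r31 =>
    refine ⟨_, _, _, isClassification_r31 h, (range_comp_fin_two (locus e) _ _).symm, ?_⟩
    rw [Row.reps, he13, he23]
    exact (range_comp_fin_two id _ _).symm
  | r3 =>
    refine ⟨_, _, _, isClassification_r3 h, (range_comp_fin_three (locus e) _ _ _).symm, ?_⟩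
    rw [Row.reps, he12, he13, hneg]
    exact (range_comp_fin_three id _ _ _).symm
  | r3l l hl =>
    refine ⟨_, _, _, isClassification_r3l hl h, (range_comp_fin_three (locus e) _ _ _).symm, ?_⟩
    rw [Row.reps, he12, he13, he23, Set.insert_comm, Set.pair_comm (bivec e 1 0 0)]
    exact (range_comp_fin_three id _ _ _).symm
  | r3l' l hl =>
    refine ⟨_, _, _, isClassification_r3l' hl h, (range_comp_fin_two (locus e) _ _).symm, ?_⟩
    rw [Row.reps, he12, hneg]
    exact (range_comp_fin_two id _ _).symm

end Classifications

theorem toQuadraticForm'_diagonal {R n : Type*} [CommRing R] [Fintype n] [DecidableEq n]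
    (w : n → R) :
    (Matrix.diagonal w).toQuadraticForm' = QuadraticMap.weightedSumSquares R w := by
  ext x
  rw [Matrix.toQuadraticForm', LinearMap.BilinMap.toQuadraticMap_apply,
    Matrix.toLinearMap₂'_apply', QuadraticMap.weightedSumSquares_apply]
  simp only [dotProduct, Matrix.mulVec_diagonal, smul_eq_mul]
  exact Finset.sum_congr rfl fun i _ => by ring

theorem toMatrix'_toQuadraticForm' {R n : Type*} [CommRing R] [Invertible (2 : R)] [Fintype n]
    [DecidableEq n] {S : Matrix n n R} (hS : S.IsSymm) :
    QuadraticForm.toMatrix' S.toQuadraticForm' = S := by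
  have hsymm (x y : n → R) :
      Matrix.toLinearMap₂' R S x y = Matrix.toLinearMap₂' R S y x := by
    rw [Matrix.toLinearMap₂'_apply', Matrix.toLinearMap₂'_apply', Matrix.dotProduct_mulVec,
      ← Matrix.mulVec_transpose, hS.eq, dotProduct_comm]
  rw [QuadraticForm.toMatrix', Matrix.toQuadraticForm',
    QuadraticMap.associated_left_inverse R hsymm,
    LinearMap.toMatrix'_toLinearMap₂']

theorem exists_det_ne_zero_mul_diagonal_mul_transpose_eq {n : ℕ} {S : Matrix (Fin n) (Fin n) ℝ}
    (hS : S.IsSymm) :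
    ∃ (Q : Matrix (Fin n) (Fin n) ℝ) (w : Fin n → SignType), Q.det ≠ 0 ∧
      Q * Matrix.diagonal (fun i => (w i : ℝ)) * Qᵀ = S := by
  have hsylvester := S.toQuadraticForm'.equivalent_signType_weighted_sum_squared
  rw [finrank_fin_fun] at hsylvester
  obtain ⟨w, ⟨T⟩⟩ := hsylvester
  have hcomp : S.toQuadraticForm' = (QuadraticMap.weightedSumSquares ℝ fun i => (w i : ℝ)).comp
      T.toLinearEquiv.toLinearMap := QuadraticMap.ext fun x => (T.map_app x).symm
  refine ⟨(LinearMap.toMatrix' T.toLinearEquiv.toLinearMap)ᵀ, w, ?_, ?_⟩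
  · rw [Matrix.det_transpose, LinearMap.det_toMatrix']
    exact T.toLinearEquiv.isUnit_det'.ne_zero
  · rw [Matrix.transpose_transpose,
      ← toMatrix'_toQuadraticForm' (Matrix.isSymm_diagonal fun i => (w i : ℝ)),
      toQuadraticForm'_diagonal, ← QuadraticForm.toMatrix'_comp, ← hcomp,
      toMatrix'_toQuadraticForm' hS]

section Congruence

variable {K L : Type*} [Field K] [LieRing L] [LieAlgebra K L] {e : Basis (Fin 3) K L}

-- Congruence by `s • Q` instead of `Q` multiplies the determinant by `s ^ 3` but the left hand
-- side by `s ^ 2` only, so any factor `c` can be turned into the determinant.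
theorem exists_structureMatrix_eq {Q N : Matrix (Fin 3) (Fin 3) K} {c : K} (hQ : Q.det ≠ 0)
    (hc : c ≠ 0) (h : Q * N * Qᵀ = c • structureMatrix e) :
    ∃ f : Basis (Fin 3) K L, structureMatrix f = N := by
  have hdet : ((c / Q.det) • Q).det = (c / Q.det) ^ 2 * c := by
    rw [Matrix.det_smul, Fintype.card_fin]
    field_simp
  have hunit : IsUnit ((c / Q.det) • Q).det := by
    rw [hdet]
    exact (mul_ne_zero (pow_ne_zero 2 (div_ne_zero hc hQ)) hc).isUnit
  refine ⟨e.map (((c / Q.det) • Q).toLinearEquiv e hunit), (structureMatrix_eq_iff e _).2 ?_⟩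
  rw [toMatrix_map_toLinearEquiv, hdet, Matrix.transpose_smul, Matrix.smul_mul, Matrix.smul_mul,
    Matrix.mul_smul, h, smul_smul, smul_smul, ← sq]

theorem exists_structureMatrix_eq_diagonal {d : Fin 3 → K} {c : K} (hc : c ≠ 0)
    (σ : Equiv.Perm (Fin 3)) (h : structureMatrix e = Matrix.diagonal ((c • d) ∘ σ)) :
    ∃ f : Basis (Fin 3) K L, structureMatrix f = Matrix.diagonal d := by
  refine exists_structureMatrix_eq (e := e) (Q := σ.permMatrix K) (c := c⁻¹) ?_
    (inv_ne_zero hc) ?_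
  · rw [Matrix.det_permutation]
    exact (Int.isUnit_iff.1 σ.sign.isUnit).elim (by simp +contextual) (by simp +contextual)
  · rw [Matrix.transpose_permMatrix, PEquiv.toMatrix_toPEquiv_mul, Equiv.Perm.permMatrix,
      PEquiv.mul_toMatrix_toPEquiv, h, Matrix.submatrix_submatrix, ← Matrix.diagonal_smul]
    ext i j
    simp [Matrix.diagonal_apply, Equiv.Perm.inv_def, hc]

theorem exists_axialVector_structureMatrix_eq (h : axialVector (structureMatrix e) ≠ 0) :
    ∃ f : Basis (Fin 3) K L, axialVector (structureMatrix f) = ![0, 0, 1] := by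
  set t := axialVector (structureMatrix e) with ht
  obtain ⟨i, hi⟩ := Function.ne_iff.1 h
  let P : Matrix (Fin 3) (Fin 3) K := Matrix.of ![Pi.single (i + 1) 1, Pi.single (i + 2) 1, t]
  have hdet : P.det = t i := by
    fin_cases i <;> simp [P, Matrix.det_fin_three]
  have hP : IsUnit P.det := hdet ▸ hi.isUnit
  have htP : ![0, 0, 1] ᵥ* P = t := by
    ext j
    simp [P, Matrix.vecMul, dotProduct, Fin.sum_univ_three]
  refine ⟨e.map (P⁻¹.toLinearEquiv e (P.isUnit_nonsing_inv_det hP)), ?_⟩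
  rw [← axialVector_structureMatrix_vecMul e, toMatrix_map_toLinearEquiv, ← ht, ← htP,
    Matrix.vecMul_vecMul, Matrix.mul_nonsing_inv P hP, Matrix.vecMul_one]

theorem structureMatrix_eq_of_axialVector_eq (h : axialVector (structureMatrix e) = ![0, 0, 1]) :
    structureMatrix e =
      !![structureMatrix e 0 0, structureMatrix e 1 0 + 1, 0;
        structureMatrix e 1 0, structureMatrix e 1 1, 0; 0, 0, 0] := by
  have hrow (j : Fin 3) : structureMatrix e 2 j = 0 := by
    simpa [h, Matrix.vecMul, dotProduct, Fin.sum_univ_three] using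
      congrFun (axialVector_vecMul_structureMatrix e) j
  have h₀ : structureMatrix e 1 2 - structureMatrix e 2 1 = 0 := congrFun h 0
  have h₁ : structureMatrix e 2 0 - structureMatrix e 0 2 = 0 := congrFun h 1
  have h₂ : structureMatrix e 0 1 - structureMatrix e 1 0 = 1 := congrFun h 2
  ext i j
  fin_cases i <;> fin_cases j <;> simp <;> grind

end Congruence

section Existence

variable {L : Type*} [LieRing L] [LieAlgebra ℝ L] {e : Basis (Fin 3) ℝ L}

theorem exists_eq_smul_comp_perm (w : Fin 3 → SignType) (hw : w ≠ 0) :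
    ∃ d ∈ [![0, 0, 1], ![0, -1, -1], ![0, 1, -1], ![1, 1, 1], ![1, 1, -1]],
      ∃ (σ : Equiv.Perm (Fin 3)) (s : SignType), s ≠ 0 ∧ w = (s • d) ∘ σ := by
  decide +revert

theorem exists_structureMatrix_eq_row_matrix_of_diagonal {w : Fin 3 → SignType} (hw : w ≠ 0)
    (h : structureMatrix e = Matrix.diagonal fun i => (w i : ℝ)) :
    ∃ (t : Row) (f : Basis (Fin 3) ℝ L), structureMatrix f = t.matrix := by
  obtain ⟨d, hd, σ, s, hs, rfl⟩ := exists_eq_smul_comp_perm w hw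
  obtain ⟨f, hf⟩ : ∃ f : Basis (Fin 3) ℝ L,
      structureMatrix f = Matrix.diagonal fun i => (d i : ℝ) := by
    refine exists_structureMatrix_eq_diagonal (e := e) (c := (s : ℝ)) (by cases s <;> simp_all) σ ?_
    rw [h]
    congr 1
    ext i
    cases s <;> simp
  simp only [List.mem_cons, List.not_mem_nil, or_false] at hd
  rcases hd with rfl | rfl | rfl | rfl | rfl
  · refine ⟨.heis, f, hf.trans ?_⟩
    ext i j
    fin_cases i <;> fin_cases j <;> simp [Row.matrix]
  · refine ⟨.r30', f, hf.trans ?_⟩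
    ext i j
    fin_cases i <;> fin_cases j <;> simp [Row.matrix]
  · refine ⟨.r3m1, exists_structureMatrix_eq (e := f) (Q := !![1, 0, 0; 0, 1, 2⁻¹; 0, 1, -2⁻¹])
      (c := 1) (by simp [Matrix.det_fin_three]; norm_num) one_ne_zero ?_⟩
    rw [hf]
    ext i j
    fin_cases i <;> fin_cases j <;>
      simp [Row.matrix, Matrix.mul_apply, Fin.sum_univ_three] <;> norm_num
  · refine ⟨.su2, f, hf.trans ?_⟩
    ext i j
    fin_cases i <;> fin_cases j <;> simp [Row.matrix]
  · refine ⟨.sl2, exists_structureMatrix_eq (e := f) (Q := !![1, 0, 0; 0, 1, 2⁻¹; 0, 1, -2⁻¹])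
      (c := 1) (by simp [Matrix.det_fin_three]; norm_num) one_ne_zero ?_⟩
    rw [hf]
    ext i j
    fin_cases i <;> fin_cases j <;>
      simp [Row.matrix, Matrix.mul_apply, Fin.sum_univ_three] <;> norm_num

theorem exists_structureMatrix_eq_row_matrix_of_unimodular
    (ht : axialVector (structureMatrix e) = 0) (he : structureMatrix e ≠ 0) :
    ∃ (t : Row) (f : Basis (Fin 3) ℝ L), structureMatrix f = t.matrix := by
  obtain ⟨Q, w, hQ, hw⟩ :=
    exists_det_ne_zero_mul_diagonal_mul_transpose_eq (axialVector_eq_zero_iff.1 ht)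
  obtain ⟨f, hf⟩ := exists_structureMatrix_eq hQ one_ne_zero (hw.trans (one_smul ℝ _).symm)
  refine exists_structureMatrix_eq_row_matrix_of_diagonal ?_ hf
  rintro rfl
  exact he (by simpa using hw.symm)

theorem exists_structureMatrix_eq_planar (ht : axialVector (structureMatrix e) = ![0, 0, 1]) :
    ∃ (w : Fin 2 → SignType) (k : ℝ) (f : Basis (Fin 3) ℝ L), k ≠ 0 ∧
      structureMatrix f = !![(w 0 : ℝ), k, 0; -k, w 1, 0; 0, 0, 0] := by
  set M := structureMatrix e with hM
  obtain ⟨Q, w, hQ, hw⟩ := exists_det_ne_zero_mul_diagonal_mul_transpose_eq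
    (S := !![M 0 0, M 1 0 + 2⁻¹; M 1 0 + 2⁻¹, M 1 1])
    (Matrix.IsSymm.ext fun i j => by fin_cases i <;> fin_cases j <;> rfl)
  have hdet : !![Q 0 0, Q 0 1, 0; Q 1 0, Q 1 1, 0; 0, 0, 1].det = Q.det := by
    simp [Matrix.det_fin_three, Matrix.det_fin_two]
  refine ⟨w, (2 * Q.det)⁻¹, (exists_structureMatrix_eq (e := e) (hdet ▸ hQ) one_ne_zero ?_).imp
    fun f hf => ⟨inv_ne_zero (mul_ne_zero two_ne_zero hQ), hf⟩⟩
  have hentry (i j : Fin 2) := congrFun (congrFun hw i) j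
  have hk : 2 * (Q 0 0 * Q 1 1 - Q 0 1 * Q 1 0) * (2 * Q.det)⁻¹ = 1 := by
    rw [← Matrix.det_fin_two]
    exact mul_inv_cancel₀ (mul_ne_zero two_ne_zero hQ)
  have h₀₀ := hentry 0 0
  have h₀₁ := hentry 0 1
  have h₁₁ := hentry 1 1
  simp only [Matrix.mul_apply, Fin.sum_univ_two, Matrix.transpose_apply, Matrix.diagonal_apply_eq,
    ne_eq, one_ne_zero, not_false_eq_true, Matrix.diagonal_apply_ne, mul_zero, add_zero,
    zero_ne_one, zero_add, Matrix.of_apply, Matrix.cons_val', Matrix.cons_val_zero,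
    Matrix.cons_val_fin_one, Matrix.cons_val_one] at h₀₀ h₀₁ h₁₁
  rw [structureMatrix_eq_of_axialVector_eq ht, one_smul, ← hM]
  ext i j
  fin_cases i <;> fin_cases j <;> simp [Matrix.mul_apply, Fin.sum_univ_three] <;> grind

variable {k : ℝ}

theorem exists_structureMatrix_eq_r31 (hk : k ≠ 0)
    (h : structureMatrix e = !![0, k, 0; -k, 0, 0; 0, 0, 0]) :
    ∃ f : Basis (Fin 3) ℝ L, structureMatrix f = Row.r31.matrix := by
  refine exists_structureMatrix_eq (e := e) (Q := !![0, 1, 0; 0, 0, 1; 1, 0, 0]) (c := k⁻¹)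
    (by simp [Matrix.det_fin_three]) (inv_ne_zero hk) ?_
  rw [h]
  ext i j
  fin_cases i <;> fin_cases j <;> simp [Row.matrix, Matrix.mul_apply, Fin.sum_univ_three, hk]

theorem exists_structureMatrix_eq_r3 {ε : ℝ} (hε : ε ^ 2 = 1) (hk : k ≠ 0)
    (h : structureMatrix e = !![ε, k, 0; -k, 0, 0; 0, 0, 0] ∨
      structureMatrix e = !![0, k, 0; -k, ε, 0; 0, 0, 0]) :
    ∃ f : Basis (Fin 3) ℝ L, structureMatrix f = Row.r3.matrix := by
  have hε₀ : ε ≠ 0 := by rintro rfl; norm_num at hε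
  rcases h with h | h
  · refine exists_structureMatrix_eq (e := e) (Q := !![1, 0, 0; 0, -ε * k, 0; 0, 0, 1]) (c := -ε)
      (by simp [Matrix.det_fin_three, hε₀, hk]) (neg_ne_zero.2 hε₀) ?_
    rw [h]
    ext i j
    fin_cases i <;> fin_cases j <;> simp [Row.matrix, Matrix.mul_apply, Fin.sum_univ_three]
    linear_combination -hε
  · refine exists_structureMatrix_eq (e := e) (Q := !![0, ε * k, 0; 1, 0, 0; 0, 0, 1]) (c := -ε)
      (by simp [Matrix.det_fin_three, hε₀, hk]) (neg_ne_zero.2 hε₀) ?_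
    rw [h]
    ext i j
    fin_cases i <;> fin_cases j <;> simp [Row.matrix, Matrix.mul_apply, Fin.sum_univ_three]
    linear_combination -hε

theorem exists_structureMatrix_eq_r3l {ε : ℝ} (hε : ε ^ 2 = 1) (hk : k ≠ 0)
    (h : structureMatrix e = !![ε, k, 0; -k, -ε, 0; 0, 0, 0]) :
    ∃ l hl, ∃ f : Basis (Fin 3) ℝ L, structureMatrix f = (Row.r3l l hl).matrix := by
  have hpos : 0 < |k| := abs_pos.2 hk
  have hsq : |k| ^ 2 = k ^ 2 := sq_abs k
  have hl : -1 < (|k| - 1) / (|k| + 1) ∧ (|k| - 1) / (|k| + 1) < 1 := by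
    rw [lt_div_iff₀ (by positivity), div_lt_one (by positivity)]
    constructor <;> linarith
  have hε₀ : ε ≠ 0 := by rintro rfl; norm_num at hε
  set l := (|k| - 1) / (|k| + 1)
  have hlk : l * (|k| + 1) = |k| - 1 := div_mul_cancel₀ _ (by positivity)
  set σ := -ε * k / |k| with hσ_def
  have hσk : σ * |k| = -ε * k := div_mul_cancel₀ _ hpos.ne'
  have hσ : σ ^ 2 = 1 := by
    rw [hσ_def, div_pow, mul_pow, neg_sq, hε, one_mul, ← hsq, div_self (by positivity)]
  have hσ₀ : σ ≠ 0 := by rintro h₀; norm_num [h₀] at hσ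
  -- The columns of `Q` are the factors of `x ^ 2 - y ^ 2 = (x + σ * y) * (x - σ * y)`, which is
  -- the quadratic form of the symmetric part up to the factor `ε`.
  refine ⟨l, hl, exists_structureMatrix_eq (e := e) (Q := !![1, 1, 0; σ, -σ, 0; 0, 0, 1])
    (c := ε * (1 - l)) (by simp [Matrix.det_fin_three]; grind)
    (mul_ne_zero hε₀ (sub_ne_zero.2 hl.2.ne')) ?_⟩
  rw [h]
  ext i j
  fin_cases i <;> fin_cases j <;> simp [Row.matrix, Matrix.mul_apply, Fin.sum_univ_three]
  all_goals grind

theorem exists_structureMatrix_eq_r3l' {ε : ℝ} (hε : ε ^ 2 = 1) (hk : k ≠ 0)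
    (h : structureMatrix e = !![ε, k, 0; -k, ε, 0; 0, 0, 0]) :
    ∃ l hl, ∃ f : Basis (Fin 3) ℝ L, structureMatrix f = (Row.r3l' l hl).matrix := by
  have hε₀ : ε ≠ 0 := by rintro rfl; norm_num at hε
  refine ⟨-ε * k, mul_ne_zero (neg_ne_zero.2 hε₀) hk,
    exists_structureMatrix_eq (e := e) (Q := 1) (c := -ε) (by simp) (neg_ne_zero.2 hε₀) ?_⟩
  rw [h]
  ext i j
  fin_cases i <;> fin_cases j <;> simp [Row.matrix]
  all_goals linear_combination -hε

theorem exists_structureMatrix_eq_row_matrix_of_planar {w : Fin 2 → SignType} (hk : k ≠ 0)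
    (h : structureMatrix e = !![(w 0 : ℝ), k, 0; -k, w 1, 0; 0, 0, 0]) :
    ∃ (t : Row) (f : Basis (Fin 3) ℝ L), structureMatrix f = t.matrix := by
  have hsq (s : SignType) (hs : s ≠ 0) : (s : ℝ) ^ 2 = 1 := by
    cases s <;> simp_all
  have hcases : ∀ s s' : SignType, s = 0 ∧ s' = 0 ∨ s ≠ 0 ∧ s' = 0 ∨ s = 0 ∧ s' ≠ 0 ∨
      s ≠ 0 ∧ s' = s ∨ s ≠ 0 ∧ s' = -s := by
    decide
  rcases hcases (w 0) (w 1) with ⟨h₀, h₁⟩ | ⟨h₀, h₁⟩ | ⟨h₀, h₁⟩ | ⟨h₀, h₁⟩ | ⟨h₀, h₁⟩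
  · rw [h₀, h₁, SignType.coe_zero] at h
    exact ⟨.r31, exists_structureMatrix_eq_r31 hk h⟩
  · rw [h₁, SignType.coe_zero] at h
    exact ⟨.r3, exists_structureMatrix_eq_r3 (hsq _ h₀) hk (.inl h)⟩
  · rw [h₀, SignType.coe_zero] at h
    exact ⟨.r3, exists_structureMatrix_eq_r3 (hsq _ h₁) hk (.inr h)⟩
  · rw [h₁] at h
    obtain ⟨l, hl, hf⟩ := exists_structureMatrix_eq_r3l' (hsq _ h₀) hk h
    exact ⟨.r3l' l hl, hf⟩
  · rw [h₁, SignType.coe_neg] at h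
    obtain ⟨l, hl, hf⟩ := exists_structureMatrix_eq_r3l (hsq _ h₀) hk h
    exact ⟨.r3l l hl, hf⟩

theorem exists_structureMatrix_eq_row_matrix (hL : finrank ℝ L = 3) (hn : ¬ IsLieAbelian L) :
    ∃ (t : Row) (f : Basis (Fin 3) ℝ L), structureMatrix f = t.matrix := by
  have : Module.Finite ℝ L := finite_of_finrank_pos (hL ▸ Nat.succ_pos 2)
  let e : Basis (Fin 3) ℝ L := finBasisOfFinrankEq ℝ L hL
  by_cases ht : axialVector (structureMatrix e) = 0
  · refine exists_structureMatrix_eq_row_matrix_of_unimodular ht fun he => hn ⟨fun u v => ?_⟩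
    apply e.equivFun.injective
    rw [equivFun_lie, he, Matrix.zero_mulVec, map_zero]
  · obtain ⟨f, hf⟩ := exists_axialVector_structureMatrix_eq ht
    obtain ⟨w, k, g, hk, hg⟩ := exists_structureMatrix_eq_planar hf
    exact exists_structureMatrix_eq_row_matrix_of_planar hk hg

end Existence

section Models

variable {R : Type*} [CommRing R] (N : Matrix (Fin 3) (Fin 3) R)

theorem axialVector_vecMul : axialVector N ᵥ* N = N *ᵥ axialVector N := by
  ext i
  fin_cases i <;>
    simp [axialVector, Matrix.vecMul, Matrix.mulVec, dotProduct, Fin.sum_univ_three] <;> ring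

theorem cross_mulVec_cross_add_cyclic (x y z : Fin 3 → R) :
    x ⨯₃ (N *ᵥ (y ⨯₃ z)) + y ⨯₃ (N *ᵥ (z ⨯₃ x)) + z ⨯₃ (N *ᵥ (x ⨯₃ y)) =
      -(x ⬝ᵥ y ⨯₃ z) • axialVector N := by
  ext i
  fin_cases i <;>
    simp [axialVector, cross_apply, Matrix.mulVec, dotProduct, Fin.sum_univ_three] <;> ring

variable {N}

theorem jacobi_mulVec_cross (hN : axialVector N ᵥ* N = 0) (x y z : Fin 3 → R) :
    N *ᵥ (x ⨯₃ (N *ᵥ (y ⨯₃ z))) =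
      N *ᵥ ((N *ᵥ (x ⨯₃ y)) ⨯₃ z) + N *ᵥ (y ⨯₃ (N *ᵥ (x ⨯₃ z))) := by
  have hcyc := congrArg (N *ᵥ ·) (cross_mulVec_cross_add_cyclic N x y z)
  simp only [Matrix.mulVec_smul, ← axialVector_vecMul, hN, smul_zero, Matrix.mulVec_add] at hcyc
  rw [← cross_anticomm z (N *ᵥ (x ⨯₃ y)), ← cross_anticomm z x, Matrix.mulVec_neg,
    Matrix.mulVec_neg, map_neg, Matrix.mulVec_neg, ← sub_eq_zero, ← hcyc]
  abel

theorem exists_structureMatrix_eq_of_vecMul_eq_zero {R : Type u} [CommRing R]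
    {N : Matrix (Fin 3) (Fin 3) R} (hN : axialVector N ᵥ* N = 0) :
    ∃ (L : Type u) (_ : LieRing L) (_ : LieAlgebra R L) (e : Basis (Fin 3) R L),
      structureMatrix e = N := by
  let _ : LieRing (Fin 3 → R) :=
    { Pi.addCommGroup with
      bracket := fun x y => N *ᵥ (x ⨯₃ y)
      add_lie := fun x y z => by
        change N *ᵥ ((x + y) ⨯₃ z) = N *ᵥ (x ⨯₃ z) + N *ᵥ (y ⨯₃ z)
        rw [map_add, LinearMap.add_apply, Matrix.mulVec_add]
      lie_add := fun x y z => by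
        change N *ᵥ (x ⨯₃ (y + z)) = N *ᵥ (x ⨯₃ y) + N *ᵥ (x ⨯₃ z)
        rw [map_add, Matrix.mulVec_add]
      lie_self := fun x => by
        change N *ᵥ (x ⨯₃ x) = 0
        rw [cross_self, Matrix.mulVec_zero]
      leibniz_lie := jacobi_mulVec_cross hN }
  let _ : LieAlgebra R (Fin 3 → R) :=
    { Pi.Function.module (Fin 3) R R with
      lie_smul := fun c x y => by
        change N *ᵥ (x ⨯₃ (c • y)) = c • N *ᵥ (x ⨯₃ y)
        rw [map_smul, Matrix.mulVec_smul] }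
  refine ⟨Fin 3 → R, inferInstance, inferInstance, Pi.basisFun R (Fin 3), ?_⟩
  exact ext_of_mulVec_cross fun u v => (equivFun_lie (Pi.basisFun R (Fin 3)) u v).symm

theorem Row.exists_relations (t : Row) :
    ∃ (M : Type) (_ : LieRing M) (_ : LieAlgebra ℝ M) (e : Basis (Fin 3) ℝ M), t.Relations e := by
  have hN : axialVector t.matrix ᵥ* t.matrix = 0 := by
    ext i
    cases t <;> fin_cases i <;>
      simp [axialVector, Row.matrix, Matrix.vecMul, dotProduct, Fin.sum_univ_three]
  obtain ⟨_, _, _, e, he⟩ := exists_structureMatrix_eq_of_vecMul_eq_zero hN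
  exact ⟨_, _, _, e, t.relations_iff.2 he⟩

end Models

end CoboundaryLie

end

theorem mainTheorem1 :
    -- the table describes Lie algebras, and all nonabelian ones of dimension three
    (∀ t : CoboundaryLie.Row, ∃ (M : Type) (_ : LieRing M) (_ : LieAlgebra ℝ M)
      (e : Module.Basis (Fin 3) ℝ M), t.Relations e) ∧
    (∀ (L : Type*) [LieRing L] [LieAlgebra ℝ L], Module.finrank ℝ L = 3 → ¬ IsLieAbelian L →
      ∃ (t : CoboundaryLie.Row) (e : Module.Basis (Fin 3) ℝ L), t.Relations e) ∧
    ∀ (L : Type*) [LieRing L] [LieAlgebra ℝ L] (t : CoboundaryLie.Row)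
      (e : Module.Basis (Fin 3) ℝ L), t.Relations e →
      -- the invariant bivectors and trivectors
      CoboundaryLie.inv2 e = t.inv2 e ∧
      CoboundaryLie.inv3 e = t.inv3 L ∧
      -- the bracket of a bivector with itself, the mCYBE and the r-matrices
      (∀ x y z : ℝ, CoboundaryLie.schoutenSq e (CoboundaryLie.bivec e x y z) =
        t.schoutenCoeff x y z • CoboundaryLie.e123 e) ∧
      {r | CoboundaryLie.MCYBE e r} = CoboundaryLie.locus e t.YB ∧
      {r | CoboundaryLie.IsRMatrix e r} = CoboundaryLie.locus e t.YB ∧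
      -- cocommutators up to automorphisms are the same as orbits of reduced r-matrices
      (∀ r r', CoboundaryLie.IsRMatrix e r → CoboundaryLie.IsRMatrix e r' →
        (CoboundaryLie.CocommutatorEquiv (CoboundaryLie.cobracket e r)
          (CoboundaryLie.cobracket e r') ↔ CoboundaryLie.ReducedEquiv e r r')) ∧
      -- the classes of nonzero coboundary cocommutators
      CoboundaryLie.nonzeroClasses e = t.classes e ∧
      -- the representatives
      (∀ r ∈ t.reps e, CoboundaryLie.IsRMatrix e r ∧ CoboundaryLie.cobracket e r ≠ 0) ∧
      (∀ δ, CoboundaryLie.IsCoboundary e δ → δ ≠ 0 →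
        ∃! r, r ∈ t.reps e ∧
          CoboundaryLie.CocommutatorEquiv δ (CoboundaryLie.cobracket e r)) := by
  refine ⟨CoboundaryLie.Row.exists_relations, fun L _ _ hL hn => ?_, fun L _ _ t e h => ?_⟩
  · obtain ⟨t, e, he⟩ := CoboundaryLie.exists_structureMatrix_eq_row_matrix hL hn
    exact ⟨t, e, t.relations_iff.2 he⟩
  · rw [t.relations_iff] at h
    obtain ⟨ι, P, ρ, hρ, hclasses, hreps⟩ := CoboundaryLie.Row.exists_isClassification h
    rw [hclasses, hreps]
    exact ⟨CoboundaryLie.Row.inv2_eq h, CoboundaryLie.Row.inv3_eq h,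
      CoboundaryLie.Row.schoutenSq_bivec h,
      CoboundaryLie.setOf_eq_locus (CoboundaryLie.Row.mcybe_iff h),
      CoboundaryLie.setOf_eq_locus fun x y z =>
        (CoboundaryLie.isRMatrix_iff_mcybe e).trans (CoboundaryLie.Row.mcybe_iff h x y z),
      fun _ _ _ _ => CoboundaryLie.cocommutatorEquiv_iff_reducedEquiv,
      hρ.nonzeroClasses_eq, Set.forall_mem_range.2 hρ.isRMatrix_rep,
      fun _ => hρ.existsUnique_rep⟩
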